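/- Let $D\ge 1$, $n_1\ge 2$, $n_2,\dots,n_D\ge 1$. Consider the $n_1\times\cdots\times n_D$ lattice, whose nodes are the integer vectors $i=(i_1,\dots,i_D)$ with $0\le i_d\le n_d-1$ and whose edges join nodes at Euclidean distance $1$; write $E$ for the set of ordered pairs of neighbours and $\mathcal N_i$ for the neighbours of $i$. The nodes with $i_1=n_1-1$ are reference vehicles, which follow their desired constant-velocity trajectories exactly; all other nodes are vehicles with dynamics $\ddot p_i=u_i$ and control $$u_i=-\sum_{j\in\mathcal N_i}k_{(i,j)}(p_i-p_j-\Delta_{i,j})-b_0(\dot p_i-v^*),$$ where $v^*$ is the desired velocity and $\Delta_{i,j}$ is the difference of the desired positions of $i$ and $j$. In the error coordinates $\tilde p=p-p^*$, $\tilde v=\dot p-v^*$ of the vehicles this is a linear system $\dot\psi=A\psi$. Its stability margin $S$ is the absolute value of the real part of the least stable eigenvalue of $A$, that is, of the eigenvalue closest to the imaginary axis. Let $i^{1+}$ and $i^{1-}$ be the neighbours of $i$ (if they exist) in the positive and the negative $x_1$ direction. Let $k_0,b_0>0$. There are $N_0\in\mathbb N$, $\varepsilon_0\in(0,k_0]$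 and $C$, depending only on $k_0$ and $b_0$, such that for all $D\ge1$, all $n_1\ge \max(N_0,2)$, all $n_2,\dots,n_D\ge 1$ and all $0<\varepsilon<\varepsilon_0$ the following holds. (a) Among all proportional gains with $|k_{(i,j)}-k_0|\le\varepsilon$ for every $(i,j)\in E$, the stability margin is maximized by $$k_{(i,i^{1+})}=k_0+\varepsilon,\qquad k_{(i,i^{1-})}=k_0-\varepsilon,\qquad k_{(i,j)}=k_0\ \text{ for all other neighbours } j.$$ Every maximizer has $k_{(i,i^{1+})}=k_0+\varepsilon$ and $k_{(i,i^{1-})}=k_0-\varepsilon$ for every vehicle $i$ and each of these neighbours that exists. (b) With the gains displayed in (a), all eigenvalues of $A$ have negative real part, and the stability margin $S$ satisfies $$\Bigl|S-\frac{2\varepsilon}{b_0(n_1-1)}\Bigr|\le C\Bigl(\frac1{n_1^2}+\varepsilon^2\Bigr);$$ in particular $S=\frac{2\varepsilon}{b_0(n_1-1)}+O(1/n_1^2)$ when $n_1\to\infty$ and $\varepsilon\to0$ with $\varepsilon=O(1/n_1)$. More precisely, if $S^{(0)}$ denotes the stability margin with the symmetric gains $k_{(i,j)}=k_0$, then $$\Bigl|S-S^{(0)}-\frac{2\varepsilon}{b_0(n_1-1)}\Bigr|\le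 C\Bigl(\frac{\varepsilon}{n_1^2}+\varepsilon^2\Bigr),\qquad S^{(0)}\le\frac{C}{n_1^2}.$$ -/

import Mathlib

/-! Vehicular formations on rectangular lattices, their closed-loop state matrix and stability
margin. The directions `x_1, …, x_D` of a `D`-dimensional lattice, `D ≥ 1`, are indexed by
`Fin (D' + 1)` with `D = D' + 1`; the index `0` is the direction `x_1`. -/

namespace Formation

/-- Nodes of the `n_1 × ⋯ × n_D` lattice: integer vectors with `0 ≤ i_d ≤ n_d - 1`. -/
abbrev Node {D : ℕ} (n : Fin (D + 1) → ℕ) : Type := (d : Fin (D + 1)) → Fin (n d)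

/-- The lattice graph: `i` and `j` are neighbours iff their (squared) Euclidean distance is `1`. -/
def lattice {D : ℕ} (n : Fin (D + 1) → ℕ) : SimpleGraph (Node n) where
  Adj i j := ∑ d, (((i d : ℕ) : ℤ) - ((j d : ℕ) : ℤ)) ^ 2 = 1
  symm := ⟨fun i j h => by
    rw [← h]
    exact Finset.sum_congr rfl fun d _ => by ring⟩
  loopless := ⟨fun i h => by simp at h⟩

instance {D : ℕ} (n : Fin (D + 1) → ℕ) : DecidableRel (lattice n).Adj :=
  fun i j => inferInstanceAs
    (Decidable (∑ d, (((i d : ℕ) : ℤ) - ((j d : ℕ) : ℤ)) ^ 2 = 1))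

/-- Reference vehicles are exactly the nodes on the face `i_1 = n_1 - 1`. -/
def IsReference {D : ℕ} {n : Fin (D + 1) → ℕ} (i : Node n) : Prop := (i 0 : ℕ) + 1 = n 0

instance {D : ℕ} {n : Fin (D + 1) → ℕ} : DecidablePred (IsReference (n := n)) :=
  fun i => inferInstanceAs (Decidable ((i 0 : ℕ) + 1 = n 0))

/-- The real vehicles: all nodes that are not reference vehicles. -/
abbrev Vehicle {D : ℕ} (n : Fin (D + 1) → ℕ) : Type := {i : Node n // ¬ IsReference i}

/-- `IsNext i j`: `j` is the neighbour of `i` in the positive `x_1` direction, `j = i^{1+}`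
(equivalently `i = j^{1-}`). -/
def IsNext {D : ℕ} {n : Fin (D + 1) → ℕ} (i j : Node n) : Prop :=
  (j 0 : ℕ) = (i 0 : ℕ) + 1 ∧ ∀ d, d ≠ 0 → j d = i d

instance {D : ℕ} {n : Fin (D + 1) → ℕ} (i j : Node n) : Decidable (IsNext i j) :=
  inferInstanceAs (Decidable ((j 0 : ℕ) = (i 0 : ℕ) + 1 ∧ ∀ d, d ≠ 0 → j d = i d))

/-- The distributed control law of vehicle `i` (one coordinate of the positions): `k` are the
proportional gains, `b` the derivative gains, `Δ` the desired relative positions, `vd` the desired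
velocity, `p` the current positions of all nodes and `v` the current velocities. -/
def control {D : ℕ} {n : Fin (D + 1) → ℕ} (k : Node n → Node n → ℝ) (b : Node n → ℝ)
    (Δ : Node n → Node n → ℝ) (vd : ℝ) (p v : Node n → ℝ) (i : Node n) : ℝ :=
  (∑ j ∈ (lattice n).neighborFinset i, -(k i j) * (p i - p j - Δ i j)) - b i * (v i - vd)

/-- The matrix of `p̃ ↦ (∑_{j ∈ N_i} k_{(i,j)} (p̃_i - p̃_j))_i` on the real vehicles, where
`p̃_j = 0` at reference vehicles `j`. -/
def stiffness {D : ℕ} {n : Fin (D + 1) → ℕ} (k : Node n → Node n → ℝ) :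
    Matrix (Vehicle n) (Vehicle n) ℝ :=
  fun i j =>
    if i = j then ∑ l ∈ (lattice n).neighborFinset i.1, k i.1 l
    else if (lattice n).Adj i.1 j.1 then -(k i.1 j.1) else 0

/-- The closed-loop state matrix: the error state `ψ = [p̃; ṽ]` of the real vehicles satisfies
`ψ' = A ψ` (see `hasDerivAt_error`). -/
def stateMatrix {D : ℕ} {n : Fin (D + 1) → ℕ} (k : Node n → Node n → ℝ) (b : Node n → ℝ) :
    Matrix (Vehicle n ⊕ Vehicle n) (Vehicle n ⊕ Vehicle n) ℝ :=
  Matrix.fromBlocks 0 1 (-(stiffness k)) (-(Matrix.diagonal fun i => b i.1))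

/-- The closed-loop eigenvalues: the complex eigenvalues of the state matrix. -/
def eigenvalues {D : ℕ} {n : Fin (D + 1) → ℕ} (k : Node n → Node n → ℝ) (b : Node n → ℝ) : Set ℂ :=
  spectrum ℂ ((stateMatrix k b).map (fun x : ℝ => (x : ℂ)))

/-- The stability margin: the absolute value of the real part of the least stable eigenvalue, i.e.
of the closed-loop eigenvalue closest to the imaginary axis. -/
noncomputable def stabilityMargin {D : ℕ} {n : Fin (D + 1) → ℕ} (k : Node n → Node n → ℝ)
    (b : Node n → ℝ) : ℝ :=
  sInf ((fun s : ℂ => |s.re|) '' eigenvalues k b)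

/-- The gain designs with `|k_{(i,j)} - k₀| ≤ ε` on every edge of the lattice. -/
def admissible {D : ℕ} (n : Fin (D + 1) → ℕ) (k₀ ε : ℝ) : Set (Node n → Node n → ℝ) :=
  {k | ∀ i j, (lattice n).Adj i j → |k i j - k₀| ≤ ε}

/-- Symmetric proportional gains: `k_{(i,j)} = k₀` everywhere. -/
def symmetricGain {D : ℕ} (n : Fin (D + 1) → ℕ) (k₀ : ℝ) : Node n → Node n → ℝ := fun _ _ => k₀

/-- The mistuned proportional gains: `k₀ + ε` towards `i^{1+}`, `k₀ - ε` towards `i^{1-}`, and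
`k₀` towards all other neighbours. -/
noncomputable def mistunedGain {D : ℕ} (n : Fin (D + 1) → ℕ) (k₀ ε : ℝ) : Node n → Node n → ℝ :=
  fun i j => if IsNext i j then k₀ + ε else if IsNext j i then k₀ - ε else k₀

/-- The action of the stiffness matrix. -/
theorem stiffness_mulVec {D : ℕ} {n : Fin (D + 1) → ℕ} (k : Node n → Node n → ℝ)
    (q : Node n → ℝ) (hq : ∀ i, IsReference i → q i = 0) (i : Vehicle n) :
    (stiffness k).mulVec (fun j => q j.1) i =
      ∑ j ∈ (lattice n).neighborFinset i.1, k i.1 j * (q i.1 - q j) := by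
  have h1 : ∀ j : Vehicle n, stiffness k i j * q j.1 =
      (if i = j then (∑ l ∈ (lattice n).neighborFinset i.1, k i.1 l) * q i.1 else 0) -
        (if (lattice n).Adj i.1 j.1 then k i.1 j.1 * q j.1 else 0) := by
    intro j
    unfold stiffness
    by_cases h : i = j
    · subst h
      simp
    · by_cases h' : (lattice n).Adj i.1 j.1 <;> simp [h, h']
  have h2 : ∑ j : Vehicle n, (if (lattice n).Adj i.1 j.1 then k i.1 j.1 * q j.1 else 0) =
      ∑ j ∈ (lattice n).neighborFinset i.1, k i.1 j * q j := by
    rw [SimpleGraph.neighborFinset_eq_filter, Finset.sum_filter,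
      ← Fintype.sum_subtype_add_sum_subtype (fun j => ¬ IsReference j)]
    rw [left_eq_add]
    refine Finset.sum_eq_zero fun j _ => ?_
    rw [hq j.1 (not_not.1 j.2)]
    simp
  simp only [Matrix.mulVec, dotProduct]
  rw [Finset.sum_congr rfl fun j _ => h1 j, Finset.sum_sub_distrib, h2]
  simp [mul_sub, Finset.sum_sub_distrib, Finset.sum_mul]

/-- If every vehicle is a double integrator driven by the control law, and the reference vehicles
follow their desired constant-velocity trajectories `t ↦ x i + vd * t`, then the error state
`[p - p*; v - vd]` of the real vehicles obeys the linear system given by `stateMatrix`. -/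
theorem hasDerivAt_error {D : ℕ} {n : Fin (D + 1) → ℕ} (k : Node n → Node n → ℝ) (b : Node n → ℝ)
    (x : Node n → ℝ) (vd : ℝ) (p v : ℝ → Node n → ℝ)
    (hp : ∀ t, ∀ i, ¬ IsReference i → HasDerivAt (fun t => p t i) (v t i) t)
    (hv : ∀ t, ∀ i, ¬ IsReference i → HasDerivAt (fun t => v t i)
      (control k b (fun i j => x i - x j) vd (p t) (v t) i) t)
    (href : ∀ t, ∀ i, IsReference i → p t i = x i + vd * t) (t : ℝ) :
    HasDerivAt (fun t => (Sum.elim (fun i : Vehicle n => p t i.1 - (x i.1 + vd * t))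
        (fun i : Vehicle n => v t i.1 - vd) : Vehicle n ⊕ Vehicle n → ℝ))
      ((stateMatrix k b).mulVec (Sum.elim (fun i : Vehicle n => p t i.1 - (x i.1 + vd * t))
        (fun i : Vehicle n => v t i.1 - vd))) t := by
  rw [hasDerivAt_pi, stateMatrix, Matrix.fromBlocks_mulVec]
  rintro (i | i)
  · have h : HasDerivAt (fun t => p t i.1 - (x i.1 + vd * t)) (v t i.1 - vd * 1) t :=
      (hp t i.1 i.2).sub (((hasDerivAt_id t).const_mul vd).const_add (x i.1))
    simpa [Function.comp_def] using h
  · have h := (hv t i.1 i.2).sub_const vd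
    have e := stiffness_mulVec k (fun j => p t j - (x j + vd * t))
      (fun j hj => by simp [href t j hj]) i
    simp only [Sum.elim_inr]
    convert h using 1
    simp only [Matrix.neg_mulVec, Pi.add_apply, Pi.neg_apply, Function.comp_def, Sum.elim_inl,
      Sum.elim_inr, Matrix.mulVec_diagonal, e, control]
    rw [sub_eq_add_neg, ← Finset.sum_neg_distrib]
    congr 1
    exact Finset.sum_congr rfl fun j _ => by ring

end Formation

/-!
By eliminating the velocities, the closed-loop eigenvalues are the roots of `s ^ 2 + b₀ s + μ = 0`,
where `μ` runs through the eigenvalues of the stiffness matrix `L` (`mem_eigenvalues_iff`). A real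
`μ ∈ [0, b₀ ^ 2 / 4]` contributes the decay rate `slowRate b₀ μ`, which increases with `μ`.

For the mistuned gains, `L` has a positive eigenvector `φ` which depends on `x_1` only and decreases
towards the reference vehicles: `φ = r ^ j sin ((n_1 - 1 - j) θ)` at the nodes with `i_1 = j`, with
`r ^ 2 = (k₀ - ε) / (k₀ + ε)` and `θ` fixed by the boundary condition at `j = 0` (`IsFundamental`,
`profile_lt`). Its eigenvalue `lam` is the smallest one, and the whole spectrum is real because
geometric weights along `x_1` symmetrize `L` (`mistuned_symmetrizable`). Hence the margin is exactly
`slowRate b₀ lam` (`stabilityMargin_mistunedGain`).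

For any other admissible design, the monotonicity of `φ` gives `L φ ≤ lam φ`. Pairing with a positive
left eigenvector of `L`, which exists by Perron's theorem (`exists_pos_eigenvector`) because the
vehicles are connected, shows that `L` has a real eigenvalue in `[0, lam]`, and one below `lam` unless
all gains along `x_1` are the mistuned ones (`exists_real_eigenvalue_le`). Therefore the margin is
at most `slowRate b₀ lam`, with equality only for these gains (`stabilityMargin_le_slowRate`). The
complex eigenvalues of a general design play no role, since only an upper bound is needed for it.

For the asymptotics, write `(n_1 - 1 / 2) θ = π / 2 + δ`. The boundary condition becomes
`tan δ * tan (θ / 2) = ε / (k₀ + √(k₀ ^ 2 - ε ^ 2))`, so `δ * θ ≈ ε / k₀`. As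
`lam = 2 k₀ - 2 √(k₀ ^ 2 - ε ^ 2) cos θ`, the shift of `lam` against the symmetric design is
`2 ε / (n_1 - 1)` up to `O(ε / n_1 ^ 2 + ε ^ 2)` (`modeValue_sub_bounds`); dividing by `b₀` gives the
shift of the margin (`slowRate_sub_bounds`).
-/

namespace Formation

open Matrix

/-! ### Positive eigenvectors and real spectra -/

/-- Perron's theorem: a nonnegative matrix `B` with positive diagonal whose only nonempty index set
closed under the support of `B` is the full one has a positive eigenvector. The eigenvalue `r` is
the largest number for which `r w ≤ B w` has a solution in the simplex. -/
theorem exists_pos_eigenvector {ι : Type*} [Fintype ι] [Nonempty ι] (B : Matrix ι ι ℝ)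
    (hB : ∀ i j, 0 ≤ B i j) (hdiag : ∀ i, 0 < B i i)
    (hconn : ∀ s : Set ι, s.Nonempty → (∀ i j, j ∈ s → 0 < B i j → i ∈ s) → ∀ i, i ∈ s) :
    ∃ (r : ℝ) (w : ι → ℝ), (∀ i, 0 < w i) ∧ B *ᵥ w = r • w := by
  classical
  have hmono : ∀ z : ι → ℝ, 0 ≤ z → 0 ≤ B *ᵥ z := fun z hz i =>
    Finset.sum_nonneg fun j _ => mul_nonneg (hB i j) (hz j)
  have hspread : ∀ z : ι → ℝ, 0 ≤ z → ∀ i j, 0 < z j → 0 < B i j → 0 < (B *ᵥ z) i :=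
    fun z hz i j hj hij => (mul_pos hij hj).trans_le
      (Finset.single_le_sum (f := fun j => B i j * z j)
        (fun j _ => mul_nonneg (hB i j) (hz j)) (Finset.mem_univ j))
  -- the largest `r` for which `r w ≤ B w` has a solution in the simplex
  let R : ℝ := ∑ i, ∑ j, B i j
  let K : Set ((ι → ℝ) × ℝ) :=
    (stdSimplex ℝ ι ×ˢ Set.Icc 0 R) ∩ {p | p.2 • p.1 ≤ B *ᵥ p.1}
  have hK : IsCompact K := by
    refine ((isCompact_stdSimplex ℝ ι).prod isCompact_Icc).inter_right ?_
    refine isClosed_le (by fun_prop) ?_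
    exact Continuous.matrix_mulVec continuous_const continuous_fst
  have hKne : K.Nonempty := by
    obtain ⟨i⟩ := ‹Nonempty ι›
    refine ⟨(Pi.single i 1, 0), ⟨⟨single_mem_stdSimplex ℝ i, le_rfl, ?_⟩, ?_⟩⟩
    · exact Finset.sum_nonneg fun i _ => Finset.sum_nonneg fun j _ => hB i j
    · simpa using hmono (Pi.single i 1) (Pi.single_nonneg.2 zero_le_one)
  obtain ⟨⟨w₀, r⟩, hw₀, hmax⟩ := hK.exists_isMaxOn hKne continuous_snd.continuousOn
  have hr : ∀ (w : ι → ℝ) (t : ℝ), 0 ≤ w → w ≠ 0 → t • w ≤ B *ᵥ w → t ≤ r := by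
    intro w t hw hw0 ht
    by_contra! hlt
    have hr0 : 0 ≤ r := hw₀.1.2.1
    have hS : 0 < ∑ i, w i := by
      obtain ⟨i, hi⟩ := Function.ne_iff.1 hw0
      exact Finset.sum_pos' (fun i _ => hw i)
        ⟨i, Finset.mem_univ i, lt_of_le_of_ne (hw i) (Ne.symm hi)⟩
    set u : ι → ℝ := (∑ i, w i)⁻¹ • w with hu
    have hu1 : u ∈ stdSimplex ℝ ι := by
      refine ⟨fun i => mul_nonneg (inv_nonneg.2 hS.le) (hw i), ?_⟩
      simp only [hu, Pi.smul_apply, smul_eq_mul, ← Finset.mul_sum]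
      exact inv_mul_cancel₀ hS.ne'
    have hut : t • u ≤ B *ᵥ u := by
      rw [hu, mulVec_smul, smul_comm]
      exact smul_le_smul_of_nonneg_left ht (inv_nonneg.2 hS.le)
    have htR : t ≤ R := by
      calc t = ∑ i, (t • u) i := by
            simp only [Pi.smul_apply, smul_eq_mul, ← Finset.mul_sum, hu1.2, mul_one]
        _ ≤ ∑ i, (B *ᵥ u) i := Finset.sum_le_sum fun i _ => hut i
        _ ≤ R := by
            refine Finset.sum_le_sum fun i _ => Finset.sum_le_sum fun j _ => ?_
            exact mul_le_of_le_one_right (hB i j)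
              (hu1.2 ▸ Finset.single_le_sum (fun j _ => hu1.1 j) (Finset.mem_univ j))
    have := hmax (a := (u, t)) ⟨⟨hu1, hr0.trans hlt.le, htR⟩, hut⟩
    exact absurd this (not_le.2 hlt)
  -- Among the solutions for this `r`, take one whose residual `B w - r w` has the largest support.
  -- Since `B w` is again a solution, with residual `B (B w - r w)`, that support is closed under `B`.
  let P : (ι → ℝ) → Prop := fun w => 0 ≤ w ∧ w ≠ 0 ∧ r • w ≤ B *ᵥ w
  let c : (ι → ℝ) → ℕ := fun w => (Finset.univ.filter fun i => 0 < (B *ᵥ w - r • w) i).card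
  have hPw : P w₀ := by
    refine ⟨hw₀.1.1.1, ?_, hw₀.2⟩
    rintro h
    have := hw₀.1.1.2
    simp [show w₀ = 0 from h] at this
  obtain ⟨w, ⟨hw, hw0, hle⟩, hwmax⟩ : ∃ w, P w ∧ ∀ v, P v → c v ≤ c w := by
    have hb : ∀ n ∈ c '' {w | P w}, n ≤ Fintype.card ι := by
      rintro _ ⟨w, -, rfl⟩
      exact Finset.card_le_univ _
    obtain ⟨w, hw, hcw⟩ := Nat.sSup_mem (s := c '' {w | P w}) ⟨_, w₀, hPw, rfl⟩ ⟨_, hb⟩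
    exact ⟨w, hw, fun v hv => hcw ▸ le_csSup ⟨_, hb⟩ ⟨v, hv, rfl⟩⟩
  set z : ι → ℝ := B *ᵥ w - r • w with hz
  have hz0 : 0 ≤ z := sub_nonneg.2 hle
  have hBz : B *ᵥ (B *ᵥ w) - r • (B *ᵥ w) = B *ᵥ z := by
    rw [hz, mulVec_sub, mulVec_smul]
  have hsupp : ∀ v : ι → ℝ, 0 ≤ v → v ≠ 0 → ∃ i, 0 < v i := fun v hv hv0 => by
    obtain ⟨i, hi⟩ := Function.ne_iff.1 hv0
    exact ⟨i, lt_of_le_of_ne (hv i) (Ne.symm hi)⟩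
  have hPB : P (B *ᵥ w) := by
    refine ⟨hmono w hw, ?_, sub_nonneg.1 (hBz ▸ hmono z hz0)⟩
    obtain ⟨i, hi⟩ := hsupp w hw hw0
    exact fun h => (hspread w hw i i hi (hdiag i)).ne' (congrFun h i)
  have hclosed : ∀ i j, 0 < z j → 0 < B i j → 0 < z i := by
    intro i j hj hij
    have hsub : (Finset.univ.filter fun i => 0 < z i) ⊆
        Finset.univ.filter fun i => 0 < (B *ᵥ z) i := fun l hl => by
      simp only [Finset.mem_filter, Finset.mem_univ, true_and] at hl ⊢
      exact hspread z hz0 l l hl (hdiag l)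
    have hcard := hwmax _ hPB
    simp only [c, hBz] at hcard
    have := Finset.eq_of_subset_of_card_le hsub hcard
    have hi : i ∈ Finset.univ.filter fun i => 0 < (B *ᵥ z) i := by
      simpa using hspread z hz0 i j hj hij
    rw [← this] at hi
    simpa using hi
  have hzz : z = 0 := by
    by_contra hne
    have hpos : ∀ i, 0 < z i := hconn {i | 0 < z i} (hsupp z hz0 hne) fun i j hj hij =>
      hclosed i j hj hij
    -- a positive residual leaves room for a larger `r`
    obtain ⟨i₀, hi₀⟩ := Finite.exists_min z
    obtain ⟨i₁, hi₁⟩ := Finite.exists_max w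
    have hw1 : 0 < w i₁ := by
      obtain ⟨i, hi⟩ := hsupp w hw hw0
      exact hi.trans_le (hi₁ i)
    have hq : 0 < z i₀ / w i₁ := div_pos (hpos i₀) hw1
    have := hr w (r + z i₀ / w i₁) hw hw0 fun i => by
      have h1 : z i₀ / w i₁ * w i ≤ z i₀ := by
        calc z i₀ / w i₁ * w i ≤ z i₀ / w i₁ * w i₁ :=
              mul_le_mul_of_nonneg_left (hi₁ i) hq.le
          _ = z i₀ := div_mul_cancel₀ _ hw1.ne'
      have h2 := hi₀ i
      have h3 : z i = (B *ᵥ w) i - r * w i := rfl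
      simp only [Pi.smul_apply, smul_eq_mul, add_mul]
      linarith
    linarith
  have heig : B *ᵥ w = r • w := sub_eq_zero.1 hzz
  refine ⟨r, w, hconn {i | 0 < w i} (hsupp w hw hw0) fun i j hj hij => ?_, heig⟩
  have h := hspread w hw i j hj hij
  rw [heig] at h
  exact lt_of_le_of_ne (hw i) fun h0 => by simp [← h0] at h

/-- If a matrix with nonpositive off-diagonal entries has a positive eigenvector `φ` with eigenvalue
`lam`, then no real eigenvalue is smaller than `lam`: compare the two eigenvalue equations in a row
where `‖x i‖ / φ i` is largest. The eigenvector `x` is allowed to be complex. -/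
theorem le_of_mulVec_eq_smul {ι : Type*} [Fintype ι] [DecidableEq ι] (L : Matrix ι ι ℝ)
    (hL : ∀ i j, i ≠ j → L i j ≤ 0) {φ : ι → ℝ} (hφ : ∀ i, 0 < φ i) {lam : ℝ}
    (hlam : L *ᵥ φ = lam • φ) {x : ι → ℂ} (hx : x ≠ 0) {μ : ℝ}
    (hμ : (L.map fun t : ℝ => (t : ℂ)) *ᵥ x = (μ : ℂ) • x) : lam ≤ μ := by
  obtain ⟨i₁, hi₁⟩ := Function.ne_iff.1 hx
  have : Nonempty ι := ⟨i₁⟩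
  obtain ⟨i, hi⟩ := Finite.exists_max fun i => ‖x i‖ / φ i
  set M := ‖x i‖ / φ i with hM
  have hxi : ‖x i‖ = M * φ i := (div_mul_cancel₀ _ (hφ i).ne').symm
  have hMpos : 0 < M := (div_pos (norm_pos_iff.2 hi₁) (hφ i₁)).trans_le (hi i₁)
  have hbound : ∀ j, ‖x j‖ ≤ M * φ j := fun j => (div_le_iff₀ (hφ j)).1 (hi j)
  have h1 : ((μ - L i i : ℝ) : ℂ) * x i = ∑ j ∈ Finset.univ.erase i, (L i j : ℂ) * x j := by
    have := congrFun hμ i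
    simp only [mulVec, dotProduct, map_apply, Pi.smul_apply, smul_eq_mul] at this
    rw [← Finset.add_sum_erase _ _ (Finset.mem_univ i)] at this
    push_cast
    linear_combination -this
  have h2 : (L i i - lam) * φ i = ∑ j ∈ Finset.univ.erase i, -L i j * φ j := by
    have := congrFun hlam i
    simp only [mulVec, dotProduct, Pi.smul_apply, smul_eq_mul] at this
    rw [← Finset.add_sum_erase _ _ (Finset.mem_univ i)] at this
    simp only [neg_mul, Finset.sum_neg_distrib]
    linear_combination this
  have h3 : |μ - L i i| * (M * φ i) ≤ (L i i - lam) * (M * φ i) := by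
    calc |μ - L i i| * (M * φ i) = ‖((μ - L i i : ℝ) : ℂ) * x i‖ := by
          rw [norm_mul, Complex.norm_real, hxi, Real.norm_eq_abs]
      _ ≤ ∑ j ∈ Finset.univ.erase i, ‖(L i j : ℂ) * x j‖ := h1 ▸ norm_sum_le _ _
      _ ≤ ∑ j ∈ Finset.univ.erase i, M * (-L i j * φ j) := by
          refine Finset.sum_le_sum fun j hj => ?_
          have hij := hL i j (Finset.ne_of_mem_erase hj).symm
          rw [norm_mul, Complex.norm_real, Real.norm_eq_abs, abs_of_nonpos hij]
          nlinarith [hbound j]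
      _ = (L i i - lam) * (M * φ i) := by rw [← Finset.mul_sum, ← h2]; ring
  have h4 := le_of_mul_le_mul_right h3 (mul_pos hMpos (hφ i))
  linarith [neg_abs_le (μ - L i i)]

/-- A real matrix which is symmetric for a weighted inner product has only real eigenvalues. -/
theorem im_eq_zero_of_symmetrizable {ι : Type*} [Fintype ι] (L : Matrix ι ι ℝ)
    {π : ι → ℝ} (hπ : ∀ i, 0 < π i) (hsymm : ∀ i j, π i * L i j = π j * L j i)
    {x : ι → ℂ} (hx : x ≠ 0) {μ : ℂ}
    (hμ : (L.map fun t : ℝ => (t : ℂ)) *ᵥ x = μ • x) : μ.im = 0 := by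
  have hq : ∑ i, ∑ j, ((π i * L i j : ℝ) : ℂ) * (star (x i) * x j) =
      μ * ((∑ i, π i * Complex.normSq (x i) : ℝ) : ℂ) := by
    rw [Complex.ofReal_sum, Finset.mul_sum]
    refine Finset.sum_congr rfl fun i _ => ?_
    have := congrFun hμ i
    simp only [mulVec, dotProduct, map_apply, Pi.smul_apply, smul_eq_mul] at this
    calc _ = (π i : ℂ) * star (x i) * ∑ j, (L i j : ℂ) * x j := by
          rw [Finset.mul_sum]
          exact Finset.sum_congr rfl fun j _ => by push_cast; ring
      _ = _ := by
          rw [this]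
          push_cast
          rw [Complex.normSq_eq_conj_mul_self]
          simp only [Complex.star_def]
          ring
  have hself : star (∑ i, ∑ j, ((π i * L i j : ℝ) : ℂ) * (star (x i) * x j)) =
      ∑ i, ∑ j, ((π i * L i j : ℝ) : ℂ) * (star (x i) * x j) := by
    simp only [star_sum, star_mul', Complex.star_def, Complex.conj_ofReal, Complex.conj_conj]
    rw [Finset.sum_comm]
    refine Finset.sum_congr rfl fun i _ => Finset.sum_congr rfl fun j _ => ?_
    rw [hsymm j i]
    ring
  have hpos : 0 < ∑ i, π i * Complex.normSq (x i) := by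
    obtain ⟨i, hi⟩ := Function.ne_iff.1 hx
    exact Finset.sum_pos' (fun i _ => mul_nonneg (hπ i).le (Complex.normSq_nonneg _))
      ⟨i, Finset.mem_univ i, mul_pos (hπ i) (Complex.normSq_pos.2 hi)⟩
  rw [hq] at hself
  have := congrArg Complex.im hself
  simp only [Complex.star_def, Complex.conj_im, Complex.im_mul_ofReal] at this
  have h0 : μ.im * ∑ i, π i * Complex.normSq (x i) = 0 := by linarith
  exact (mul_eq_zero.1 h0).resolve_right hpos.ne'

variable {D : ℕ} {n : Fin (D + 1) → ℕ}

/-! ### Closed-loop eigenvalues and the stability margin -/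

/-- Eliminating the velocity block: the closed-loop eigenvalues are the roots `s` of
`s ^ 2 + b s + μ = 0` as `μ` runs through the complex eigenvalues of the stiffness matrix. -/
theorem mem_eigenvalues_iff (k : Node n → Node n → ℝ) (b : ℝ) (s : ℂ) :
    s ∈ eigenvalues k (fun _ => b) ↔ ∃ x : Vehicle n → ℂ, x ≠ 0 ∧
      ((stiffness k).map fun t : ℝ => (t : ℂ)) *ᵥ x = (-(s ^ 2 + b * s)) • x := by
  have hblock : (stateMatrix k fun _ => b).map (fun t : ℝ => (t : ℂ)) =
      fromBlocks 0 1 (-((stiffness k).map fun t : ℝ => (t : ℂ)))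
        (-(diagonal fun _ => (b : ℂ))) := by
    ext (i | i) (j | j)
    · simp [stateMatrix]
    · by_cases h : i = j <;> simp [stateMatrix, one_apply, h]
    · simp [stateMatrix]
    · by_cases h : i = j <;> simp [stateMatrix, h]
  rw [eigenvalues, ← Matrix.spectrum_toLin', ← Module.End.hasEigenvalue_iff_mem_spectrum, hblock]
  constructor
  · intro h
    obtain ⟨v, hv⟩ := h.exists_hasEigenvector
    have hv1 := hv.apply_eq_smul
    rw [toLin'_apply, fromBlocks_mulVec] at hv1
    have htop : ∀ i, v (Sum.inr i) = s * v (Sum.inl i) := fun i => by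
      simpa using congrFun hv1 (Sum.inl i)
    have hbot : ∀ i, -(((stiffness k).map fun t : ℝ => (t : ℂ)) *ᵥ (v ∘ Sum.inl)) i
        - b * v (Sum.inr i) = s * v (Sum.inr i) := fun i => by
      simpa [neg_mulVec, mulVec_diagonal, ← sub_eq_add_neg] using congrFun hv1 (Sum.inr i)
    refine ⟨v ∘ Sum.inl, fun h0 => hv.2 ?_, funext fun i => ?_⟩
    · have hl : ∀ i, v (Sum.inl i) = 0 := fun i => congrFun h0 i
      ext (i | i)
      · exact hl i
      · simp [htop, hl]
    · have := hbot i
      rw [htop] at this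
      simp only [Pi.smul_apply, Function.comp_apply, smul_eq_mul]
      linear_combination -this
  · rintro ⟨x, hx0, hx⟩
    refine Module.End.hasEigenvalue_of_hasEigenvector (x := Sum.elim x (s • x)) ⟨?_, ?_⟩
    · rw [Module.End.mem_eigenspace_iff, toLin'_apply, fromBlocks_mulVec]
      ext (i | i)
      · simp
      · have := congrFun hx i
        simp only [Pi.smul_apply, smul_eq_mul] at this
        simp [neg_mulVec, this]
        ring
    · intro h0
      exact hx0 (funext fun i => congrFun h0 (Sum.inl i))

/-- The decay rate of the slower mode of `q'' + b q' + μ q = 0`: the smaller root `σ` of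
`σ ^ 2 - b σ + μ = 0`. This reading requires `4 μ ≤ b ^ 2`; beyond that the square root is `0` and
the value is `b / 2`. -/
noncomputable def slowRate (b μ : ℝ) : ℝ := (b - √(b ^ 2 - 4 * μ)) / 2

theorem slowRate_eq {b μ : ℝ} (h : 4 * μ ≤ b ^ 2) :
    slowRate b μ ^ 2 - b * slowRate b μ + μ = 0 := by
  have := Real.sq_sqrt (sub_nonneg.2 h)
  unfold slowRate
  linear_combination this / 4

theorem slowRate_le (b μ : ℝ) : slowRate b μ ≤ b / 2 := by
  unfold slowRate
  linarith [Real.sqrt_nonneg (b ^ 2 - 4 * μ)]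

theorem slowRate_nonneg {b μ : ℝ} (hb : 0 ≤ b) (hμ : 0 ≤ μ) : 0 ≤ slowRate b μ := by
  have : √(b ^ 2 - 4 * μ) ≤ b := Real.sqrt_le_iff.2 ⟨hb, by linarith⟩
  unfold slowRate
  linarith

theorem slowRate_le_slowRate {b μ ν : ℝ} (h : μ ≤ ν) : slowRate b μ ≤ slowRate b ν := by
  have : √(b ^ 2 - 4 * ν) ≤ √(b ^ 2 - 4 * μ) := Real.sqrt_le_sqrt (by linarith)
  unfold slowRate
  linarith

theorem slowRate_lt_slowRate {b μ ν : ℝ} (h : μ < ν) (hν : 4 * ν ≤ b ^ 2) :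
    slowRate b μ < slowRate b ν := by
  have : √(b ^ 2 - 4 * ν) < √(b ^ 2 - 4 * μ) := Real.sqrt_lt_sqrt (by linarith) (by linarith)
  unfold slowRate
  linarith

/-- Every root of `s ^ 2 + b s + μ = 0` with `μ ≥ lam` real decays at least at the rate
`slowRate b lam`, including the complex roots, whose real part is `-b / 2`. -/
theorem slowRate_le_neg_re {b lam μ : ℝ} (hb : 0 < b) (hlam : 0 < lam)
    (hlam' : 4 * lam ≤ b ^ 2) (hμ : lam ≤ μ) {s : ℂ} (hs : s ^ 2 + b * s + μ = 0) :
    s.re < 0 ∧ slowRate b lam ≤ |s.re| := by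
  have hre := congrArg Complex.re hs
  have him := congrArg Complex.im hs
  simp only [pow_two, Complex.add_re, Complex.mul_re, Complex.ofReal_re, Complex.ofReal_im,
    Complex.add_im, Complex.mul_im, Complex.zero_re, Complex.zero_im, zero_mul, sub_zero,
    add_zero] at hre him
  have hfac : (2 * s.re + b) * s.im = 0 := by linarith
  rcases mul_eq_zero.1 hfac with h | h
  · have h1 : s.re = -(b / 2) := by linarith
    rw [h1, abs_neg, abs_of_pos (half_pos hb)]
    exact ⟨by linarith, slowRate_le b lam⟩
  · rw [h] at hre
    have hneg : s.re < 0 := by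
      by_contra! hge
      nlinarith [mul_nonneg hb.le hge, mul_self_nonneg s.re]
    refine ⟨hneg, ?_⟩
    rw [abs_of_neg hneg]
    by_contra! hlt
    have hle := slowRate_le b lam
    have heq := slowRate_eq hlam'
    nlinarith [mul_pos (sub_pos.2 hlt) (show 0 < b - slowRate b lam - -s.re by linarith)]

theorem ofReal_mulVec {ι : Type*} [Fintype ι] (L : Matrix ι ι ℝ) (x : ι → ℝ) :
    (L.map fun t : ℝ => (t : ℂ)) *ᵥ (fun i => (x i : ℂ)) = fun i => ((L *ᵥ x) i : ℂ) := by
  ext i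
  simp [mulVec, dotProduct]

theorem neg_slowRate_mem_eigenvalues (k : Node n → Node n → ℝ) {b μ : ℝ}
    (hμ : 4 * μ ≤ b ^ 2) {x : Vehicle n → ℝ} (hx : x ≠ 0) (h : stiffness k *ᵥ x = μ • x) :
    ((-slowRate b μ : ℝ) : ℂ) ∈ eigenvalues k (fun _ => b) := by
  rw [mem_eigenvalues_iff]
  refine ⟨fun i => (x i : ℂ), fun h0 => hx (funext fun i => ?_), ?_⟩
  · simpa using congrFun h0 i
  · rw [ofReal_mulVec, h]
    have := slowRate_eq hμ
    ext i
    have h2 : μ = -((-slowRate b μ) ^ 2 + b * (-slowRate b μ)) := by linarith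
    simp only [Pi.smul_apply, smul_eq_mul, Complex.ofReal_mul]
    nth_rewrite 1 [h2]
    push_cast
    ring

/-- A single real eigenvalue of the stiffness matrix bounds the stability margin from above. -/
theorem stabilityMargin_le (k : Node n → Node n → ℝ) {b μ : ℝ} (hb : 0 ≤ b) (hμ0 : 0 ≤ μ)
    (hμ : 4 * μ ≤ b ^ 2) {x : Vehicle n → ℝ} (hx : x ≠ 0) (h : stiffness k *ᵥ x = μ • x) :
    stabilityMargin k (fun _ => b) ≤ slowRate b μ := by
  refine csInf_le ⟨0, ?_⟩ ⟨_, neg_slowRate_mem_eigenvalues k hμ hx h, ?_⟩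
  · rintro _ ⟨s, -, rfl⟩
    exact abs_nonneg _
  · simp only [Complex.ofReal_re, abs_neg]
    exact abs_of_nonneg (slowRate_nonneg hb hμ0)

theorem stiffness_nonpos {k : Node n → Node n → ℝ} (hk : ∀ i j, (lattice n).Adj i j → 0 ≤ k i j)
    (i j : Vehicle n) (hij : i ≠ j) : stiffness k i j ≤ 0 := by
  unfold stiffness
  rw [if_neg hij]
  split_ifs with h
  · linarith [hk _ _ h]
  · exact le_rfl

/-- For a symmetrizable stiffness matrix with a positive eigenvector, the eigenvalue of that
eigenvector alone determines the stability margin. -/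
theorem symmetrizable_spectrum {k : Node n → Node n → ℝ}
    (hk : ∀ i j, (lattice n).Adj i j → 0 ≤ k i j) {π : Vehicle n → ℝ} (hπ : ∀ i, 0 < π i)
    (hsymm : ∀ i j : Vehicle n, π i * stiffness k i j = π j * stiffness k j i)
    {φ : Vehicle n → ℝ} (hφ : ∀ i, 0 < φ i) (hne : φ ≠ 0) {b lam : ℝ} (hb : 0 < b)
    (hlam : 0 < lam) (hlam' : 4 * lam ≤ b ^ 2) (h : stiffness k *ᵥ φ = lam • φ) :
    (∀ s ∈ eigenvalues k (fun _ => b), s.re < 0) ∧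
      stabilityMargin k (fun _ => b) = slowRate b lam := by
  have key : ∀ s ∈ eigenvalues k (fun _ => b), s.re < 0 ∧ slowRate b lam ≤ |s.re| := by
    intro s hs
    obtain ⟨x, hx0, hx⟩ := (mem_eigenvalues_iff k b s).1 hs
    have him := im_eq_zero_of_symmetrizable _ hπ hsymm hx0 hx
    have hreal : (((-(s ^ 2 + b * s)).re : ℝ) : ℂ) = -(s ^ 2 + b * s) :=
      Complex.ext (by simp) (by simpa using him.symm)
    rw [← hreal] at hx
    have hle := le_of_mulVec_eq_smul _ (stiffness_nonpos hk) hφ h hx0 hx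
    exact slowRate_le_neg_re hb hlam hlam' hle (by rw [hreal]; ring)
  refine ⟨fun s hs => (key s hs).1, le_antisymm (stabilityMargin_le k hb.le hlam.le hlam' hne h) ?_⟩
  refine le_csInf ⟨_, _, neg_slowRate_mem_eigenvalues k hlam' hne h, rfl⟩ ?_
  rintro _ ⟨s, hs, rfl⟩
  exact (key s hs).2

/-! ### Connectedness of the vehicles and the comparison principle -/

theorem adj_update_sub_one (i : Node n) (d : Fin (D + 1)) (hd : 0 < (i d : ℕ))
    (h : (i d : ℕ) - 1 < n d) :
    (lattice n).Adj i (Function.update i d ⟨(i d : ℕ) - 1, h⟩) := by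
  change ∑ e, _ = (1 : ℤ)
  rw [Finset.sum_eq_single d]
  · simp only [Function.update_self]
    rw [Nat.cast_sub hd]
    simp
  · intro e _ he
    simp [Function.update_of_ne he]
  · simp

/-- The graph of the real vehicles is connected: lowering any nonzero coordinate leads from a
vehicle to a neighbouring one, and finally to the origin. -/
theorem vehicle_connected (hn0 : 2 ≤ n 0) (hn : ∀ d, 1 ≤ n d) (s : Set (Vehicle n))
    (hne : s.Nonempty)
    (hs : ∀ i j : Vehicle n, (lattice n).Adj i.1 j.1 → j ∈ s → i ∈ s) (i : Vehicle n) : i ∈ s := by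
  let o : Vehicle n := ⟨fun d => ⟨0, hn d⟩, by simp only [IsReference]; omega⟩
  have key : ∀ N : ℕ, ∀ i : Vehicle n, ∑ d, (i.1 d : ℕ) = N → (i ∈ s ↔ o ∈ s) := by
    intro N
    induction N using Nat.strong_induction_on with
    | _ N ih =>
      intro i hi
      by_cases h0 : ∀ d, (i.1 d : ℕ) = 0
      · have : i = o := Subtype.ext (funext fun d => Fin.ext (h0 d))
        rw [this]
      · push Not at h0
        obtain ⟨d, hd⟩ := h0
        have hlt : (i.1 d : ℕ) - 1 < n d := by omega
        have hadj := adj_update_sub_one i.1 d (Nat.pos_of_ne_zero hd) hlt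
        have hle : ∀ e, ((Function.update i.1 d ⟨(i.1 d : ℕ) - 1, hlt⟩ : Node n) e : ℕ)
            ≤ (i.1 e : ℕ) := by
          intro e
          by_cases he : e = d
          · subst he
            simp
          · simp [Function.update_of_ne he]
        let i' : Vehicle n := ⟨Function.update i.1 d ⟨(i.1 d : ℕ) - 1, hlt⟩, by
          have h1 := hle 0
          have h2 := i.2
          have h3 := (i.1 0).2
          simp only [IsReference] at h2 ⊢
          omega⟩
        have hsum : ∑ e, (i'.1 e : ℕ) < N := by
          rw [← hi]
          refine Finset.sum_lt_sum (fun e _ => hle e) ⟨d, Finset.mem_univ d, ?_⟩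
          simp only [i', Function.update_self]
          omega
        rw [← ih _ hsum i' rfl]
        exact ⟨hs i' i hadj.symm, hs i i' hadj⟩
  obtain ⟨j, hj⟩ := hne
  exact (key _ i rfl).2 ((key _ j rfl).1 hj)

/-- The stiffness matrix with positive gains has a positive left eigenvector, by Perron's theorem
for `c - Lᵀ` with a large constant `c`. -/
theorem exists_left_eigenvector (hn0 : 2 ≤ n 0) (hn : ∀ d, 1 ≤ n d) {k : Node n → Node n → ℝ}
    (hk : ∀ i j, (lattice n).Adj i j → 0 < k i j) :
    ∃ (μ : ℝ) (w : Vehicle n → ℝ), (∀ i, 0 < w i) ∧ w ᵥ* stiffness k = μ • w := by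
  have : Nonempty (Vehicle n) :=
    ⟨⟨fun d => ⟨0, hn d⟩, by simp only [IsReference]; omega⟩⟩
  obtain ⟨i₁, hi₁⟩ := Finite.exists_max fun i : Vehicle n => stiffness k i i
  set c : ℝ := stiffness k i₁ i₁ + 1 with hc
  have hdiag : ∀ i : Vehicle n, 0 < c - stiffness k i i := fun i => by linarith [hi₁ i]
  set B : Matrix (Vehicle n) (Vehicle n) ℝ := c • 1 - (stiffness k)ᵀ with hB
  have hnonneg : ∀ i j, 0 ≤ B i j := by
    intro i j
    by_cases hij : i = j
    · subst hij
      simpa [hB] using (hdiag i).le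
    · have := stiffness_nonpos (fun i j h => (hk i j h).le) j i (Ne.symm hij)
      simpa [hB, one_apply, hij] using this
  have hpos : ∀ i, 0 < B i i := fun i => by simpa [hB] using hdiag i
  obtain ⟨r, w, hw, h⟩ := exists_pos_eigenvector B hnonneg hpos fun s hne hs =>
    vehicle_connected hn0 hn s hne fun i j hadj hj => hs i j hj <| by
      have hij : i ≠ j := fun h => hadj.ne (congrArg _ h)
      have := hk _ _ hadj.symm
      simpa [hB, one_apply, hij, stiffness, hij.symm, hadj.symm] using this
  refine ⟨c - r, w, hw, ?_⟩
  rw [hB, sub_mulVec, smul_mulVec, one_mulVec, mulVec_transpose] at h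
  rw [sub_smul, ← h]
  abel

/-- Comparison principle: a positive `φ` with `L φ ≤ lam φ` forces the stiffness matrix `L` to have a
real eigenvalue in `[0, lam]`, and one strictly below `lam` if the inequality is strict somewhere.
Pair the inequality with the positive left eigenvector. -/
theorem exists_real_eigenvalue_le (hn0 : 2 ≤ n 0) (hn : ∀ d, 1 ≤ n d) {k : Node n → Node n → ℝ}
    (hk : ∀ i j, (lattice n).Adj i j → 0 < k i j) {φ : Node n → ℝ}
    (hφ : ∀ i, ¬ IsReference i → 0 < φ i) (hφ0 : ∀ i, IsReference i → φ i = 0) {lam : ℝ}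
    (hle : ∀ i, ¬ IsReference i →
      ∑ j ∈ (lattice n).neighborFinset i, k i j * (φ i - φ j) ≤ lam * φ i) :
    ∃ (μ : ℝ) (x : Vehicle n → ℝ), x ≠ 0 ∧ stiffness k *ᵥ x = μ • x ∧ 0 ≤ μ ∧ μ ≤ lam ∧
      ((∃ i, ¬ IsReference i ∧
        ∑ j ∈ (lattice n).neighborFinset i, k i j * (φ i - φ j) < lam * φ i) → μ < lam) := by
  obtain ⟨μ, w, hw, h⟩ := exists_left_eigenvector hn0 hn hk
  have o : Vehicle n := ⟨fun d => ⟨0, hn d⟩, by simp only [IsReference]; omega⟩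
  have hpair : ∀ y : Vehicle n → ℝ, ∑ i, w i * (stiffness k *ᵥ y) i = μ * ∑ i, w i * y i := by
    intro y
    have h1 : w ⬝ᵥ (stiffness k *ᵥ y) = (μ • w) ⬝ᵥ y := by rw [dotProduct_mulVec, h]
    rwa [smul_dotProduct, smul_eq_mul] at h1
  have hx : ∃ x : Vehicle n → ℝ, x ≠ 0 ∧ stiffness k *ᵥ x = μ • x := by
    have hdet : (stiffness k - μ • (1 : Matrix (Vehicle n) (Vehicle n) ℝ)).det = 0 := by
      refine exists_vecMul_eq_zero_iff.1 ⟨w, fun h0 => (hw o).ne' (congrFun h0 o), ?_⟩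
      rw [vecMul_sub, h, vecMul_smul, vecMul_one, sub_self]
    obtain ⟨x, hx0, hx⟩ := exists_mulVec_eq_zero_iff.2 hdet
    refine ⟨x, hx0, ?_⟩
    rwa [sub_mulVec, smul_mulVec, one_mulVec, sub_eq_zero] at hx
  obtain ⟨x, hx0, hx⟩ := hx
  have hμ0 : 0 ≤ μ := by
    have hpos : 0 < ∑ i, w i * (1 : ℝ) :=
      Finset.sum_pos (fun i _ => by simpa using hw i) ⟨o, Finset.mem_univ o⟩
    refine nonneg_of_mul_nonneg_left ?_ hpos
    rw [← hpair fun _ => 1]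
    refine Finset.sum_nonneg fun i _ => mul_nonneg (hw i).le ?_
    have e := stiffness_mulVec k (fun j => if IsReference j then 0 else 1) (by simp +contextual) i
    have e2 : (fun j : Vehicle n => if IsReference j.1 then (0 : ℝ) else 1) = fun _ => 1 :=
      funext fun j => if_neg j.2
    rw [e2] at e
    rw [e]
    refine Finset.sum_nonneg fun j hj => ?_
    have hkj := (hk i.1 j ((SimpleGraph.mem_neighborFinset _ _ _).1 hj)).le
    refine mul_nonneg hkj ?_
    rw [if_neg i.2]
    split_ifs <;> norm_num
  have hφpos : 0 < ∑ i : Vehicle n, w i * φ i.1 :=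
    Finset.sum_pos (fun i _ => mul_pos (hw i) (hφ i.1 i.2)) ⟨o, Finset.mem_univ o⟩
  have hlam : lam * ∑ i : Vehicle n, w i * φ i.1 = ∑ i : Vehicle n, w i * (lam * φ i.1) := by
    rw [Finset.mul_sum]
    exact Finset.sum_congr rfl fun i _ => by ring
  refine ⟨μ, x, hx0, hx, hμ0, ?_, ?_⟩
  · refine le_of_mul_le_mul_right ?_ hφpos
    rw [← hpair fun j => φ j.1, hlam]
    refine Finset.sum_le_sum fun i _ => mul_le_mul_of_nonneg_left ?_ (hw i).le
    rw [stiffness_mulVec k φ hφ0 i]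
    exact hle i.1 i.2
  · rintro ⟨i, hi, hlt⟩
    refine lt_of_mul_lt_mul_right ?_ hφpos.le
    rw [← hpair fun j => φ j.1, hlam]
    refine Finset.sum_lt_sum (fun i _ => mul_le_mul_of_nonneg_left ?_ (hw i).le)
      ⟨⟨i, hi⟩, Finset.mem_univ _, mul_lt_mul_of_pos_left ?_ (hw _)⟩
    · rw [stiffness_mulVec k φ hφ0 i]
      exact hle i.1 i.2
    · rw [stiffness_mulVec k φ hφ0 ⟨i, hi⟩]
      exact hlt

/-! ### The mistuned design on functions of the first coordinate -/

theorem IsNext.adj {i j : Node n} (h : IsNext i j) : (lattice n).Adj i j := by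
  change ∑ e, _ = (1 : ℤ)
  rw [Finset.sum_eq_single 0]
  · rw [h.1]
    simp
  · intro e _ he
    simp [h.2 e he]
  · simp

theorem IsNext.not_isNext {i j : Node n} (h : IsNext i j) : ¬ IsNext j i := fun h' => by
  have := h.1
  have := h'.1
  omega

/-- Two neighbours are consecutive in the `x_1` direction or have the same first coordinate. -/
theorem adj_cases {i j : Node n} (h : (lattice n).Adj i j) :
    IsNext i j ∨ IsNext j i ∨ (j 0 : ℕ) = i 0 := by
  have h : ∑ e, (((i e : ℕ) : ℤ) - ((j e : ℕ) : ℤ)) ^ 2 = 1 := h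
  by_cases h0 : (j 0 : ℕ) = i 0
  · exact Or.inr (Or.inr h0)
  have hsplit := Finset.add_sum_erase Finset.univ
    (fun e => (((i e : ℕ) : ℤ) - ((j e : ℕ) : ℤ)) ^ 2) (Finset.mem_univ 0)
  rw [h] at hsplit
  have hge : 1 ≤ (((i 0 : ℕ) : ℤ) - ((j 0 : ℕ) : ℤ)) ^ 2 := by
    have : (((i 0 : ℕ) : ℤ) - ((j 0 : ℕ) : ℤ)) ≠ 0 := by omega
    have := sq_pos_of_ne_zero this
    omega
  have hnn : ∀ e ∈ Finset.univ.erase (0 : Fin (D + 1)),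
      0 ≤ (((i e : ℕ) : ℤ) - ((j e : ℕ) : ℤ)) ^ 2 := fun e _ => sq_nonneg _
  have hrest := Finset.sum_nonneg hnn
  have hzero := (Finset.sum_eq_zero_iff_of_nonneg hnn).1 (by linarith)
  have hother : ∀ e, e ≠ 0 → (i e : ℕ) = j e := fun e he => by
    have := hzero e (by simp [he])
    have := pow_eq_zero_iff two_ne_zero |>.1 this
    omega
  have hsq : (((i 0 : ℕ) : ℤ) - ((j 0 : ℕ) : ℤ)) ^ 2 = 1 := by linarith
  rcases sq_eq_one_iff.1 hsq with h1 | h1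
  · exact Or.inr (Or.inl ⟨by omega, fun e he => Fin.ext (hother e he)⟩)
  · exact Or.inl ⟨by omega, fun e he => Fin.ext (hother e he).symm⟩

theorem exists_isNext {i : Node n} (hi : ¬ IsReference i) : ∃ j, IsNext i j := by
  have h1 : (i 0 : ℕ) + 1 ≠ n 0 := hi
  have h2 := (i 0).2
  refine ⟨Function.update i 0 ⟨(i 0 : ℕ) + 1, by omega⟩, ?_, fun d hd => ?_⟩
  · simp
  · simp [Function.update_of_ne hd]

theorem exists_isNext_left {i : Node n} (hi : (i 0 : ℕ) ≠ 0) : ∃ j, IsNext j i := by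
  have h2 := (i 0).2
  refine ⟨Function.update i 0 ⟨(i 0 : ℕ) - 1, by omega⟩, ?_, fun d hd => ?_⟩
  · simp only [Function.update_self]
    omega
  · simp [Function.update_of_ne hd]

theorem IsNext.right_unique {i j j' : Node n} (h : IsNext i j) (h' : IsNext i j') : j' = j := by
  funext d
  by_cases hd : d = 0
  · subst hd
    exact Fin.ext (h'.1.trans h.1.symm)
  · rw [h.2 d hd, h'.2 d hd]

theorem IsNext.left_unique {i j j' : Node n} (h : IsNext j i) (h' : IsNext j' i) : j' = j := by
  funext d
  by_cases hd : d = 0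
  · subst hd
    have := h.1
    have := h'.1
    exact Fin.ext (by omega)
  · rw [← h.2 d hd, ← h'.2 d hd]

/-- On functions of the first coordinate, the stiffness matrix of the mistuned design acts as a
one-dimensional operator. -/
theorem sum_mistunedGain (k₀ ε : ℝ) (f : ℕ → ℝ) {i : Node n} (hi : ¬ IsReference i) :
    ∑ j ∈ (lattice n).neighborFinset i, mistunedGain n k₀ ε i j * (f (i 0) - f (j 0)) =
      (k₀ + ε) * (f (i 0) - f (i 0 + 1)) +
        if (i 0 : ℕ) = 0 then 0 else (k₀ - ε) * (f (i 0) - f (i 0 - 1)) := by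
  have hterm : ∀ j ∈ (lattice n).neighborFinset i,
      mistunedGain n k₀ ε i j * (f (i 0) - f (j 0)) =
        (if IsNext i j then (k₀ + ε) * (f (i 0) - f (i 0 + 1)) else 0) +
        (if IsNext j i then (k₀ - ε) * (f (i 0) - f (i 0 - 1)) else 0) := by
    intro j hj
    rcases adj_cases ((SimpleGraph.mem_neighborFinset _ _ _).1 hj) with h | h | h
    · simp [mistunedGain, h, h.not_isNext, h.1]
    · simp [mistunedGain, h, h.not_isNext, h.1]
    · have h1 : ¬ IsNext i j := fun h' => by
        have := h'.1
        omega
      have h2 : ¬ IsNext j i := fun h' => by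
        have := h'.1
        omega
      simp [h1, h2, h]
  rw [Finset.sum_congr rfl hterm, Finset.sum_add_distrib]
  congr 1
  · obtain ⟨j, hj⟩ := exists_isNext hi
    rw [Finset.sum_eq_single_of_mem j ((SimpleGraph.mem_neighborFinset _ _ _).2 hj.adj), if_pos hj]
    exact fun j' _ hne => if_neg fun h' => hne (hj.right_unique h')
  · split_ifs with h0
    · refine Finset.sum_eq_zero fun j _ => if_neg fun h' => ?_
      have := h'.1
      omega
    · obtain ⟨j, hj⟩ := exists_isNext_left h0
      rw [Finset.sum_eq_single_of_mem j ((SimpleGraph.mem_neighborFinset _ _ _).2 hj.adj.symm),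
        if_pos hj]
      exact fun j' _ hne => if_neg fun h' => hne (hj.left_unique h')

theorem mistunedGain_mem_admissible {k₀ ε : ℝ} (hε : 0 ≤ ε) :
    mistunedGain n k₀ ε ∈ admissible n k₀ ε := by
  intro i j _
  unfold mistunedGain
  split_ifs <;> simp [abs_of_nonneg hε, hε]

theorem mistunedGain_zero (k₀ : ℝ) : mistunedGain n k₀ 0 = symmetricGain n k₀ := by
  funext i j
  simp [mistunedGain, symmetricGain]

theorem admissible_pos {k₀ ε : ℝ} (hεk : ε < k₀) {k : Node n → Node n → ℝ}
    (hk : k ∈ admissible n k₀ ε) (i j : Node n) (h : (lattice n).Adj i j) : 0 < k i j := by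
  have := (abs_le.1 (hk i j h)).1
  linarith

/-- Detailed balance: geometric weights along `x_1` symmetrize the mistuned stiffness matrix. -/
theorem mistuned_symmetrizable {k₀ ε : ℝ} (hεk : ε < k₀) (i j : Vehicle n) :
    ((k₀ + ε) / (k₀ - ε)) ^ (i.1 0 : ℕ) * stiffness (mistunedGain n k₀ ε) i j =
      ((k₀ + ε) / (k₀ - ε)) ^ (j.1 0 : ℕ) * stiffness (mistunedGain n k₀ ε) j i := by
  have h2 : k₀ - ε ≠ 0 := by linarith
  by_cases hij : i = j
  · rw [hij]
  simp only [stiffness, if_neg hij, if_neg (Ne.symm hij), (lattice n).adj_comm j.1 i.1]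
  split_ifs with hadj
  · rcases adj_cases hadj with h | h | h
    · simp only [mistunedGain, h, h.not_isNext, h.1, pow_succ, if_true, if_false]
      field_simp
    · simp only [mistunedGain, h, h.not_isNext, h.1, pow_succ, if_true, if_false]
      field_simp
    · have h1 : ¬ IsNext i.1 j.1 := fun h' => by
        have := h'.1
        omega
      have h2 : ¬ IsNext j.1 i.1 := fun h' => by
        have := h'.1
        omega
      simp [mistunedGain, h1, h2, h]
  · simp

/-! ### The lowest mode of the mistuned chain -/

/-- The geometric mean of the two gains `k₀ + ε` and `k₀ - ε`. -/
noncomputable def meanGain (k₀ ε : ℝ) : ℝ := √(k₀ ^ 2 - ε ^ 2)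

theorem meanGain_sq {k₀ ε : ℝ} (hε : 0 ≤ ε) (hεk : ε < k₀) :
    meanGain k₀ ε ^ 2 = k₀ ^ 2 - ε ^ 2 :=
  Real.sq_sqrt (by nlinarith)

theorem meanGain_pos {k₀ ε : ℝ} (hε : 0 ≤ ε) (hεk : ε < k₀) : 0 < meanGain k₀ ε :=
  Real.sqrt_pos.2 (by nlinarith)

theorem meanGain_le {k₀ ε : ℝ} (hk : 0 ≤ k₀) : meanGain k₀ ε ≤ k₀ :=
  Real.sqrt_le_iff.2 ⟨hk, by nlinarith [sq_nonneg ε]⟩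

/-- The ratio `√((k₀ - ε) / (k₀ + ε))` of the geometric factor in the eigenvectors of the mistuned
chain. -/
noncomputable def decayRatio (k₀ ε : ℝ) : ℝ := meanGain k₀ ε / (k₀ + ε)

theorem decayRatio_pos {k₀ ε : ℝ} (hε : 0 ≤ ε) (hεk : ε < k₀) : 0 < decayRatio k₀ ε :=
  div_pos (meanGain_pos hε hεk) (by linarith)

theorem decayRatio_le_one {k₀ ε : ℝ} (hε : 0 ≤ ε) (hεk : ε < k₀) : decayRatio k₀ ε ≤ 1 :=
  (div_le_one (by linarith)).2 (by linarith [meanGain_le (k₀ := k₀) (ε := ε) (by linarith)])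

theorem add_mul_decayRatio {k₀ ε : ℝ} (hε : 0 ≤ ε) (hεk : ε < k₀) :
    (k₀ + ε) * decayRatio k₀ ε = meanGain k₀ ε :=
  mul_div_cancel₀ _ (by linarith)

theorem meanGain_mul_decayRatio {k₀ ε : ℝ} (hε : 0 ≤ ε) (hεk : ε < k₀) :
    meanGain k₀ ε * decayRatio k₀ ε = k₀ - ε := by
  have h : k₀ + ε ≠ 0 := by linarith
  rw [decayRatio, ← mul_div_assoc, ← pow_two, meanGain_sq hε hεk, div_eq_iff h]
  ring

/-- `θ` is a frequency of the lowest mode of the mistuned chain with `N` nodes: the solution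
`r ^ j sin ((N - 1 - j) θ)`, where `r = decayRatio k₀ ε`, of the interior equations vanishes at the
reference node `j = N - 1`, is positive on the other nodes, and takes equal values at `j = 0` and
at the fictitious node `j = -1`, which encodes the missing neighbour of the node `0`. -/
structure IsFundamental (N : ℕ) (k₀ ε θ : ℝ) : Prop where
  pos : 0 < θ
  lt : N * θ < Real.pi
  boundary : Real.sin (N * θ) = decayRatio k₀ ε * Real.sin ((N - 1) * θ)

/-- The eigenvalue of the stiffness matrix that belongs to the frequency `θ`. -/
noncomputable def modeValue (k₀ ε θ : ℝ) : ℝ := 2 * k₀ - 2 * meanGain k₀ ε * Real.cos θ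

/-- The mode with frequency `θ` of the mistuned chain with `N` nodes. -/
noncomputable def profile (N : ℕ) (k₀ ε θ : ℝ) (j : ℕ) : ℝ :=
  decayRatio k₀ ε ^ j * Real.sin ((N - 1 - j) * θ)

section Mode

variable {N : ℕ} {k₀ ε θ : ℝ}

theorem exists_isFundamental (hN : 2 ≤ N) (hε : 0 ≤ ε) (hεk : ε < k₀) :
    ∃ θ, IsFundamental N k₀ ε θ := by
  have hN' : (2 : ℝ) ≤ N := by exact_mod_cast hN
  set r := decayRatio k₀ ε with hr
  have hr0 : 0 < r := decayRatio_pos hε hεk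
  have hr1 : r ≤ 1 := decayRatio_le_one hε hεk
  have hpi := Real.pi_pos
  let F : ℝ → ℝ := fun θ => Real.sin (N * θ) - r * Real.sin ((N - 1) * θ)
  have ha : 0 ≤ F (Real.pi / (2 * N)) := by
    have h1 : N * (Real.pi / (2 * N)) = Real.pi / 2 := by field_simp
    simp only [F, h1, Real.sin_pi_div_two]
    have := Real.sin_le_one ((N - 1) * (Real.pi / (2 * N)))
    nlinarith
  have hb : F (Real.pi / N) < 0 := by
    have h1 : N * (Real.pi / N) = Real.pi := by field_simp
    have h2 : ((N : ℝ) - 1) * (Real.pi / N) = Real.pi - Real.pi / N := by field_simp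
    simp only [F, h1, h2, Real.sin_pi, Real.sin_pi_sub]
    have : 0 < Real.sin (Real.pi / N) := Real.sin_pos_of_pos_of_lt_pi (by positivity)
      (div_lt_self hpi (by linarith))
    nlinarith
  have hab : Real.pi / (2 * N) ≤ Real.pi / N :=
    div_le_div_of_nonneg_left hpi.le (by linarith) (by linarith)
  have hcont : ContinuousOn F (Set.Icc (Real.pi / (2 * N)) (Real.pi / N)) := by
    apply Continuous.continuousOn
    fun_prop
  obtain ⟨θ, hθ, h0⟩ := intermediate_value_Icc' hab hcont ⟨hb.le, ha⟩
  refine ⟨θ, lt_of_lt_of_le (by positivity) hθ.1, ?_, sub_eq_zero.1 h0⟩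
  have hlt : θ < Real.pi / N := lt_of_le_of_ne hθ.2 fun h => by
    rw [h] at h0
    exact hb.ne h0
  rwa [lt_div_iff₀ (by linarith), mul_comm] at hlt

theorem IsFundamental.lt_pi (h : IsFundamental N k₀ ε θ) (hN : 1 ≤ N) : θ < Real.pi := by
  have hN' : (1 : ℝ) ≤ N := by exact_mod_cast hN
  nlinarith [h.pos, h.lt]

theorem profile_pos (h : IsFundamental N k₀ ε θ) (hε : 0 ≤ ε) (hεk : ε < k₀) {j : ℕ}
    (hj : j + 1 < N) : 0 < profile N k₀ ε θ j := by
  have hj' : (j : ℝ) + 1 < N := by exact_mod_cast hj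
  refine mul_pos (pow_pos (decayRatio_pos hε hεk) _) (Real.sin_pos_of_pos_of_lt_pi ?_ ?_)
  · exact mul_pos (by linarith) h.pos
  · have : 0 ≤ (j : ℝ) := j.cast_nonneg
    nlinarith [h.pos, h.lt]

theorem profile_reference {j : ℕ} (hj : j + 1 = N) : profile N k₀ ε θ j = 0 := by
  have hj' : (N : ℝ) = j + 1 := by exact_mod_cast hj.symm
  simp [profile, hj']

theorem modeValue_pos (hε : 0 ≤ ε) (hεk : ε < k₀) (hθ : 0 < θ) (hθ' : θ < Real.pi) :
    0 < modeValue k₀ ε θ := by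
  have h1 : Real.cos θ < 1 := by
    rw [← Real.cos_zero]
    exact Real.cos_lt_cos_of_nonneg_of_le_pi le_rfl hθ'.le hθ
  have h2 := meanGain_pos hε hεk
  have h3 := meanGain_le (k₀ := k₀) (ε := ε) (by linarith)
  unfold modeValue
  nlinarith

theorem profile_recurrence_zero (h : IsFundamental N k₀ ε θ) (hε : 0 ≤ ε) (hεk : ε < k₀) :
    (k₀ + ε) * (profile N k₀ ε θ 0 - profile N k₀ ε θ 1) =
      modeValue k₀ ε θ * profile N k₀ ε θ 0 := by
  have h1 := add_mul_decayRatio hε hεk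
  have h2 := meanGain_mul_decayRatio hε hεk
  have hb := h.boundary
  have e1 : Real.sin (N * θ) = Real.sin ((N - 1) * θ) * Real.cos θ +
      Real.cos ((N - 1) * θ) * Real.sin θ := by rw [← Real.sin_add]; ring_nf
  have e2 : Real.sin ((N - 1 - 1) * θ) = Real.sin ((N - 1) * θ) * Real.cos θ -
      Real.cos ((N - 1) * θ) * Real.sin θ := by rw [← Real.sin_sub]; ring_nf
  simp only [profile, modeValue, pow_zero, pow_one, Nat.cast_zero, Nat.cast_one, sub_zero, one_mul]
  rw [e2]
  rw [e1] at hb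
  linear_combination (-Real.sin ((N - 1) * θ) * Real.cos θ +
    Real.cos ((N - 1) * θ) * Real.sin θ) * h1 + meanGain k₀ ε * hb + Real.sin ((N - 1) * θ) * h2

theorem profile_recurrence_succ (hε : 0 ≤ ε) (hεk : ε < k₀) (j : ℕ) :
    (k₀ + ε) * (profile N k₀ ε θ (j + 1) - profile N k₀ ε θ (j + 2)) +
        (k₀ - ε) * (profile N k₀ ε θ (j + 1) - profile N k₀ ε θ j) =
      modeValue k₀ ε θ * profile N k₀ ε θ (j + 1) := by
  have h1 := add_mul_decayRatio hε hεk
  have h2 := meanGain_mul_decayRatio hε hεk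
  set r := decayRatio k₀ ε
  set y := ((N : ℝ) - 1 - (j + 1 : ℕ)) * θ with hy
  have e1 : Real.sin ((N - 1 - (j + 2 : ℕ)) * θ) = Real.sin y * Real.cos θ -
      Real.cos y * Real.sin θ := by
    rw [← Real.sin_sub, hy]
    push_cast
    ring_nf
  have e2 : Real.sin ((N - 1 - j) * θ) = Real.sin y * Real.cos θ +
      Real.cos y * Real.sin θ := by
    rw [← Real.sin_add, hy]
    push_cast
    ring_nf
  simp only [profile, modeValue]
  rw [e1, e2, ← hy]
  simp only [pow_succ]
  linear_combination (-(r ^ j * r) * (Real.sin y * Real.cos θ - Real.cos y * Real.sin θ)) * h1 +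
    (r ^ j * (Real.sin y * Real.cos θ + Real.cos y * Real.sin θ)) * h2

/-- The lowest mode decreases strictly towards the reference node, because by the eigenvalue equation
each weighted downward step `(k₀ + ε) * (profile j - profile (j + 1))` exceeds the previous step times
`k₀ - ε` by `modeValue * profile > 0`. -/
theorem profile_lt (hN : 2 ≤ N) (h : IsFundamental N k₀ ε θ) (hε : 0 ≤ ε) (hεk : ε < k₀) {j : ℕ}
    (hj : j + 1 < N) : profile N k₀ ε θ (j + 1) < profile N k₀ ε θ j := by
  have hlam := modeValue_pos hε hεk h.pos (h.lt_pi (by omega))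
  have hpos : 0 < k₀ + ε := by linarith
  induction j with
  | zero =>
    have h1 := profile_recurrence_zero h hε hεk
    have h2 := mul_pos hlam (profile_pos h hε hεk hj)
    rw [← h1] at h2
    exact sub_pos.1 (pos_of_mul_pos_right h2 hpos.le)
  | succ j ih =>
    have h1 := profile_recurrence_succ (N := N) (θ := θ) hε hεk j
    have h2 := mul_pos hlam (profile_pos h hε hεk hj)
    have h3 := mul_pos (sub_pos.2 hεk) (sub_pos.2 (ih (by omega)))
    have h4 : 0 < (k₀ + ε) * (profile N k₀ ε θ (j + 1) - profile N k₀ ε θ (j + 2)) := by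
      linarith
    exact sub_pos.1 (pos_of_mul_pos_right h4 hpos.le)

end Mode

/-! ### Stability margin and optimality of the mistuned design -/

theorem not_isReference_lt {i : Node n} (hi : ¬ IsReference i) : (i 0 : ℕ) + 1 < n 0 := by
  have h1 : (i 0 : ℕ) + 1 ≠ n 0 := hi
  have h2 := (i 0).2
  omega

theorem sum_mistunedGain_profile {k₀ ε θ : ℝ} (h : IsFundamental (n 0) k₀ ε θ) (hε : 0 ≤ ε)
    (hεk : ε < k₀) {i : Node n} (hi : ¬ IsReference i) :
    ∑ j ∈ (lattice n).neighborFinset i, mistunedGain n k₀ ε i j *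
        (profile (n 0) k₀ ε θ (i 0) - profile (n 0) k₀ ε θ (j 0)) =
      modeValue k₀ ε θ * profile (n 0) k₀ ε θ (i 0) := by
  rw [sum_mistunedGain k₀ ε _ hi]
  split_ifs with h0
  · rw [h0, add_zero]
    exact profile_recurrence_zero h hε hεk
  · obtain ⟨m, hm⟩ := Nat.exists_eq_succ_of_ne_zero h0
    rw [hm]
    exact profile_recurrence_succ hε hεk m

theorem stabilityMargin_mistunedGain (hn0 : 2 ≤ n 0) (hn : ∀ d, 1 ≤ n d) {k₀ b ε θ : ℝ}
    (hb : 0 < b) (hε : 0 ≤ ε) (hεk : ε < k₀) (h : IsFundamental (n 0) k₀ ε θ)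
    (hlam : 4 * modeValue k₀ ε θ ≤ b ^ 2) :
    (∀ s ∈ eigenvalues (mistunedGain n k₀ ε) (fun _ => b), s.re < 0) ∧
      stabilityMargin (mistunedGain n k₀ ε) (fun _ => b) = slowRate b (modeValue k₀ ε θ) := by
  have hadm := mistunedGain_mem_admissible (n := n) (k₀ := k₀) hε
  have o : Vehicle n := ⟨fun d => ⟨0, hn d⟩, by simp only [IsReference]; omega⟩
  have hφ : ∀ i : Vehicle n, 0 < profile (n 0) k₀ ε θ (i.1 0) := fun i =>
    profile_pos h hε hεk (not_isReference_lt i.2)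
  refine symmetrizable_spectrum (fun i j hij => (admissible_pos hεk hadm i j hij).le)
    (π := fun i => ((k₀ + ε) / (k₀ - ε)) ^ (i.1 0 : ℕ)) (fun i => ?_)
    (mistuned_symmetrizable hεk) hφ (fun h0 => (hφ o).ne' (congrFun h0 o)) hb
    (modeValue_pos hε hεk h.pos (h.lt_pi (by omega))) hlam (funext fun i => ?_)
  · exact pow_pos (div_pos (by linarith) (by linarith)) _
  · rw [stiffness_mulVec _ (fun j => profile (n 0) k₀ ε θ (j 0)) (fun j hj => profile_reference hj) i]
    exact sum_mistunedGain_profile h hε hεk i.2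

/-- Optimality. Let `φ` be the lowest mode of the mistuned design. Since `φ` decreases along `x_1` and
depends on `x_1` only, the mistuned gains maximize each term `k i j * (φ i - φ j)`; so `L φ ≤ lam φ`
for every admissible design, with a strict inequality unless all gains along `x_1` are the
mistuned ones. -/
theorem stabilityMargin_le_slowRate (hn0 : 2 ≤ n 0) (hn : ∀ d, 1 ≤ n d) {k₀ b ε θ : ℝ}
    (hb : 0 < b) (hε : 0 ≤ ε) (hεk : ε < k₀) (h : IsFundamental (n 0) k₀ ε θ)
    (hlam : 4 * modeValue k₀ ε θ ≤ b ^ 2) {k : Node n → Node n → ℝ}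
    (hk : k ∈ admissible n k₀ ε) :
    stabilityMargin k (fun _ => b) ≤ slowRate b (modeValue k₀ ε θ) ∧
      (stabilityMargin k (fun _ => b) = slowRate b (modeValue k₀ ε θ) →
        ∀ i j : Node n, ¬ IsReference i →
          (IsNext i j → k i j = k₀ + ε) ∧ (IsNext j i → k i j = k₀ - ε)) := by
  set f := profile (n 0) k₀ ε θ with hf
  have hnext : ∀ i j : Node n, ¬ IsReference i → IsNext i j → f (j 0) < f (i 0) :=
    fun i j hi hij => by
      rw [hij.1]
      exact profile_lt hn0 h hε hεk (not_isReference_lt hi)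
  have hprev : ∀ i j : Node n, ¬ IsReference i → IsNext j i → f (i 0) < f (j 0) :=
    fun i j hi hij => hnext j i (fun hj => by
      have h1 := hij.1
      have h2 : (j 0 : ℕ) + 1 = n 0 := hj
      have h3 := not_isReference_lt hi
      omega) hij
  have hterm : ∀ i, ¬ IsReference i → ∀ j ∈ (lattice n).neighborFinset i,
      k i j * (f (i 0) - f (j 0)) ≤ mistunedGain n k₀ ε i j * (f (i 0) - f (j 0)) := by
    intro i hi j hj
    have hadj := (SimpleGraph.mem_neighborFinset _ _ _).1 hj
    have hkij := abs_le.1 (hk i j hadj)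
    rcases adj_cases hadj with hij | hij | hij
    · simp only [mistunedGain, hij, if_true]
      exact mul_le_mul_of_nonneg_right (by linarith) (sub_nonneg.2 (hnext i j hi hij).le)
    · simp only [mistunedGain, hij, hij.not_isNext, if_true, if_false]
      exact mul_le_mul_of_nonpos_right (by linarith) (sub_nonpos.2 (hprev i j hi hij).le)
    · simp [hij]
  obtain ⟨μ, x, hx0, hx, hμ0, hμ, hlt⟩ := exists_real_eigenvalue_le hn0 hn (admissible_pos hεk hk)
    (φ := fun i => f (i 0)) (lam := modeValue k₀ ε θ)
    (fun i hi => profile_pos h hε hεk (not_isReference_lt hi)) (fun i hi => profile_reference hi)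
    (fun i hi => by
      rw [← sum_mistunedGain_profile h hε hεk hi]
      exact Finset.sum_le_sum (hterm i hi))
  have hle := stabilityMargin_le k hb.le hμ0 (by linarith) hx0 hx
  refine ⟨hle.trans (slowRate_le_slowRate hμ), fun heq i j hi => ?_⟩
  -- a single strict inequality lowers the real eigenvalue, hence the margin
  have hcontra : ∀ (hadj : (lattice n).Adj i j),
      ¬ k i j * (f (i 0) - f (j 0)) < mistunedGain n k₀ ε i j * (f (i 0) - f (j 0)) := by
    intro hadj hs
    have := slowRate_lt_slowRate (b := b) (hlt ⟨i, hi, by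
      rw [← sum_mistunedGain_profile h hε hεk hi]
      exact Finset.sum_lt_sum (hterm i hi) ⟨j, (SimpleGraph.mem_neighborFinset _ _ _).2 hadj, hs⟩⟩)
      hlam
    linarith
  refine ⟨fun hij => ?_, fun hij => ?_⟩
  · have hkij := abs_le.1 (hk i j hij.adj)
    by_contra hne
    refine hcontra hij.adj ?_
    simp only [mistunedGain, hij, if_true]
    exact mul_lt_mul_of_pos_right (lt_of_le_of_ne (by linarith) hne)
      (sub_pos.2 (hnext i j hi hij))
  · have hkij := abs_le.1 (hk i j hij.adj.symm)
    by_contra hne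
    refine hcontra hij.adj.symm ?_
    simp only [mistunedGain, hij, hij.not_isNext, if_true, if_false]
    exact mul_lt_mul_of_neg_right (lt_of_le_of_ne (by linarith) (Ne.symm hne))
      (sub_neg.2 (hprev i j hi hij))

/-! ### Asymptotics of the lowest eigenvalue -/

/-- Both bounds come from `tan δ * tan (θ / 2) = η`: the upper one from `x ≤ tan x`, the lower one
from `sin δ * cos δ ≤ δ`, which gives `tan δ - tan δ ^ 2 ≤ δ`. -/
theorem phaseShift_bounds {δ θ η : ℝ} (hδ : 0 ≤ δ) (hδ' : δ < Real.pi / 2) (hθ : 0 < θ)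
    (hθ' : θ < Real.pi)
    (h : Real.sin δ * Real.sin (θ / 2) = η * (Real.cos δ * Real.cos (θ / 2))) :
    δ * θ ≤ 2 * η ∧ 2 * η - η * θ ^ 2 / 4 - 4 * η ^ 2 / θ ≤ δ * θ := by
  have hcδ : 0 < Real.cos δ := Real.cos_pos_of_mem_Ioo ⟨by linarith [Real.pi_pos], hδ'⟩
  have hcθ : 0 < Real.cos (θ / 2) :=
    Real.cos_pos_of_mem_Ioo ⟨by linarith [Real.pi_pos], by linarith⟩
  have hT : δ ≤ Real.tan δ := Real.le_tan hδ hδ'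
  have hτ : θ / 2 ≤ Real.tan (θ / 2) := Real.le_tan (by linarith) (by linarith)
  have hTτ : Real.tan δ * Real.tan (θ / 2) = η := by
    rw [Real.tan_eq_sin_div_cos, Real.tan_eq_sin_div_cos, div_mul_div_comm, h]
    exact mul_div_cancel_right₀ _ (mul_pos hcδ hcθ).ne'
  have hτs : Real.tan (θ / 2) * Real.cos (θ / 2) = Real.sin (θ / 2) :=
    Real.tan_mul_cos hcθ.ne'
  have hTs : Real.tan δ * Real.cos δ = Real.sin δ := Real.tan_mul_cos hcδ.ne'
  set T := Real.tan δ
  set τ := Real.tan (θ / 2)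
  have hT0 : 0 ≤ T := hδ.trans hT
  have hη : 0 ≤ η := hTτ ▸ mul_nonneg hT0 (by linarith)
  have hTθ : T * θ ≤ 2 * η := by nlinarith
  refine ⟨by nlinarith, ?_⟩
  have hsδ := Real.sin_le hδ
  have hs0 : 0 ≤ Real.sin δ := by rw [← hTs]; exact mul_nonneg hT0 hcδ.le
  have h1 : T - T ^ 2 ≤ δ := by
    have h2 : Real.sin δ * Real.cos δ ≤ δ :=
      (mul_le_of_le_one_right hs0 (Real.cos_le_one δ)).trans hsδ
    have h3 : Real.sin δ * Real.cos δ = T * (1 - Real.sin δ ^ 2) := by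
      rw [← hTs, mul_assoc, ← pow_two, Real.cos_sq', hTs]
    have h4 : Real.sin δ ^ 2 ≤ T := by nlinarith [Real.sin_le_one δ]
    nlinarith
  have h2 : η * (2 - θ ^ 2 / 4) ≤ T * θ := by
    have h3 := Real.sin_le (show 0 ≤ θ / 2 by linarith)
    have h4 := Real.one_sub_sq_div_two_le_cos (x := θ / 2)
    have h5 : T * Real.sin (θ / 2) = η * Real.cos (θ / 2) := by rw [← hτs, ← mul_assoc, hTτ]
    nlinarith
  have h3 : T ^ 2 * θ ≤ 4 * η ^ 2 / θ := by
    rw [le_div_iff₀ hθ]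
    nlinarith [mul_nonneg hT0 hθ.le]
  nlinarith

theorem cos_sub_cos_bounds {θ₀ θ : ℝ} (h₀ : 0 < θ₀) (h : θ₀ ≤ θ) (hθ : θ ≤ Real.pi / 2) :
    (θ ^ 2 - θ₀ ^ 2) / 2 * (1 - θ ^ 2 / 3) ≤ Real.cos θ₀ - Real.cos θ ∧
      Real.cos θ₀ - Real.cos θ ≤ (θ ^ 2 - θ₀ ^ 2) / 2 := by
  set a := (θ + θ₀) / 2 with ha
  set c := (θ - θ₀) / 2 with hc
  have hX : Real.cos θ₀ - Real.cos θ = 2 * (Real.sin a * Real.sin c) := by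
    rw [← neg_sub, Real.cos_sub_cos]
    ring
  have hprod : (θ ^ 2 - θ₀ ^ 2) / 2 = 2 * (a * c) := by rw [ha, hc]; ring
  have ha0 : 0 ≤ a := by linarith
  have hc0 : 0 ≤ c := by linarith
  have haθ : a ≤ θ := by linarith
  have hca : c ≤ a := by linarith
  have hθ2 : θ ≤ 1.6 := by linarith [Real.pi_lt_d2]
  rw [hX, hprod]
  have hsa := Real.sin_ge_sub_cube ha0
  have hsc := Real.sin_ge_sub_cube hc0
  have ha2 : a ^ 2 ≤ θ ^ 2 := by nlinarith
  have hc2 : c ^ 2 ≤ θ ^ 2 := by nlinarith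
  have hθ6 : θ ^ 2 ≤ 3 := by nlinarith
  constructor
  · have h1 : 0 ≤ a * (1 - a ^ 2 / 6) := mul_nonneg ha0 (by linarith)
    have h2 : 0 ≤ c * (1 - c ^ 2 / 6) := mul_nonneg hc0 (by linarith)
    have h3 : a * (1 - a ^ 2 / 6) * (c * (1 - c ^ 2 / 6)) ≤ Real.sin a * Real.sin c :=
      mul_le_mul (by linarith) (by linarith) h2 (by linarith)
    have h4 : 1 - θ ^ 2 / 3 ≤ (1 - a ^ 2 / 6) * (1 - c ^ 2 / 6) := by
      nlinarith [mul_nonneg (sq_nonneg a) (sq_nonneg c)]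
    have h5 := mul_le_mul_of_nonneg_left h4 (mul_nonneg ha0 hc0)
    linarith
  · have h1 := mul_le_mul (Real.sin_le ha0) (Real.sin_le hc0)
      (by nlinarith [mul_nonneg hc0 (show 0 ≤ 1 - c ^ 2 / 6 by linarith)]) ha0
    linarith

/-- If the phase shift `m (θ - θ₀)` times `θ` is `2 η` up to small errors, then the gap
`cos θ₀ - cos θ ≈ θ (θ - θ₀)` is `2 η / m` up to small errors. -/
theorem cos_gap_bounds {m θ₀ θ η : ℝ} (hm : 1 ≤ m) (hmθ₀ : m * θ₀ = Real.pi / 2) (hθθ₀ : θ₀ ≤ θ)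
    (hθ' : θ ≤ Real.pi / 2) (hη0 : 0 ≤ η) (hup : m * (θ - θ₀) * θ ≤ 2 * η)
    (hlo : 2 * η - η * θ ^ 2 / 4 - 4 * η ^ 2 / θ ≤ m * (θ - θ₀) * θ) :
    Real.cos θ₀ - Real.cos θ ≤ 2 * η / m ∧
      2 * η / m - 2 * (η * θ ^ 2) - 6 * η ^ 2 ≤ Real.cos θ₀ - Real.cos θ := by
  have hm0 : 0 < m := by linarith
  have hθ₀0 : 0 < θ₀ := pos_of_mul_pos_right (hmθ₀ ▸ Real.pi_div_two_pos) hm0.le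
  have hθ : 0 < θ := hθ₀0.trans_le hθθ₀
  have hmθ : 1 ≤ m * θ := by
    have h1 := mul_le_mul_of_nonneg_left hθθ₀ hm0.le
    linarith [Real.pi_gt_three]
  obtain ⟨hX1, hX2⟩ := cos_sub_cos_bounds hθ₀0 hθθ₀ hθ'
  have hq : m * (θ - θ₀) * θ / m = θ * (θ - θ₀) := by
    field_simp
  have hq1 : θ * (θ - θ₀) ≤ 2 * η / m := by
    rw [← hq]
    exact div_le_div_of_nonneg_right hup hm0.le
  have hq2 : 2 * η / m - η * θ ^ 2 - 4 * η ^ 2 ≤ θ * (θ - θ₀) := by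
    rw [← hq, le_div_iff₀ hm0]
    have h1 : η * θ ^ 2 / 4 ≤ η * θ ^ 2 * m := by
      nlinarith [mul_nonneg hη0 (sq_nonneg θ)]
    have h2 : 4 * η ^ 2 / θ ≤ 4 * η ^ 2 * m := by
      rw [div_le_iff₀ hθ, mul_assoc]
      exact le_mul_of_one_le_right (by positivity) hmθ
    have h3 : 2 * η / m * m = 2 * η := div_mul_cancel₀ _ hm0.ne'
    linarith
  have hθs : 0 ≤ θ - θ₀ := sub_nonneg.2 hθθ₀
  have hq3 : (θ - θ₀) ^ 2 ≤ 4 * η ^ 2 := by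
    have h1 : θ - θ₀ ≤ 2 * η := by
      have h2 : m * (θ - θ₀) * θ ≤ 2 * η := hup
      have h3 := mul_le_mul_of_nonneg_right hmθ hθs
      linarith
    calc (θ - θ₀) ^ 2 ≤ (2 * η) ^ 2 := pow_le_pow_left₀ hθs h1 2
      _ = 4 * η ^ 2 := by ring
  have hQ : (θ ^ 2 - θ₀ ^ 2) / 2 = θ * (θ - θ₀) - (θ - θ₀) ^ 2 / 2 := by ring
  have hXup : Real.cos θ₀ - Real.cos θ ≤ 2 * η / m := by linarith [sq_nonneg (θ - θ₀)]
  have hXlo : 2 * η / m - 2 * (η * θ ^ 2) - 6 * η ^ 2 ≤ Real.cos θ₀ - Real.cos θ := by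
    have h1 : (θ ^ 2 - θ₀ ^ 2) / 2 ≤ 2 * η := by
      have : 2 * η / m ≤ 2 * η := div_le_self (by linarith) (by linarith)
      linarith [sq_nonneg (θ - θ₀)]
    have h3 := mul_le_mul_of_nonneg_right h1 (sq_nonneg θ)
    have h4 : (θ ^ 2 - θ₀ ^ 2) / 2 * (1 - θ ^ 2 / 3) =
        (θ ^ 2 - θ₀ ^ 2) / 2 - (θ ^ 2 - θ₀ ^ 2) / 2 * θ ^ 2 / 3 := by ring
    rw [h4] at hX1
    linarith [mul_nonneg hη0 (sq_nonneg θ)]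
  exact ⟨hXup, hXlo⟩

/-- The relative asymmetry `ε / (k₀ + κ) = (1 - r) / (1 + r)` of the mistuned gains, where
`κ = meanGain k₀ ε` and `r = decayRatio k₀ ε`. -/
noncomputable def asymmetry (k₀ ε : ℝ) : ℝ := ε / (k₀ + meanGain k₀ ε)

section Asymmetry

variable {k₀ ε : ℝ}

theorem asymmetry_nonneg (hε : 0 ≤ ε) (hεk : ε < k₀) : 0 ≤ asymmetry k₀ ε :=
  div_nonneg hε (by linarith [meanGain_pos hε hεk])

theorem meanGain_sub (hε : 0 ≤ ε) (hεk : ε < k₀) :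
    k₀ - meanGain k₀ ε = ε * asymmetry k₀ ε := by
  have h1 := meanGain_sq hε hεk
  have h2 := meanGain_pos hε hεk
  have h3 : k₀ + meanGain k₀ ε ≠ 0 := by linarith
  unfold asymmetry
  field_simp
  linear_combination -h1

theorem mul_asymmetry_le (hε : 0 ≤ ε) (hεk : ε < k₀) : k₀ * asymmetry k₀ ε ≤ ε := by
  have h := meanGain_pos hε hεk
  rw [asymmetry, ← mul_div_assoc, div_le_iff₀ (by linarith)]
  nlinarith

theorem asymmetry_le_one (hε : 0 ≤ ε) (hεk : ε < k₀) : asymmetry k₀ ε ≤ 1 := by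
  have h1 := mul_asymmetry_le hε hεk
  nlinarith

theorem two_mul_asymmetry (hε : 0 ≤ ε) (hεk : ε < k₀) :
    2 * k₀ * asymmetry k₀ ε = ε + ε * asymmetry k₀ ε ^ 2 := by
  have h1 : k₀ + meanGain k₀ ε ≠ 0 := by linarith [meanGain_pos hε hεk]
  have h2 := meanGain_sq hε hεk
  unfold asymmetry
  field_simp
  linear_combination (-ε) * h2

theorem mul_asymmetry_le_sq_div (hε : 0 ≤ ε) (hεk : ε < k₀) :
    ε * asymmetry k₀ ε ≤ ε ^ 2 / k₀ := by
  rw [le_div_iff₀ (by linarith)]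
  nlinarith [mul_asymmetry_le hε hεk]

theorem mul_asymmetry_sq_le (hε : 0 ≤ ε) (hεk : ε < k₀) :
    k₀ * asymmetry k₀ ε ^ 2 ≤ ε ^ 2 / k₀ := by
  have hk : 0 < k₀ := hε.trans_lt hεk
  rw [le_div_iff₀ hk]
  calc k₀ * asymmetry k₀ ε ^ 2 * k₀ = (k₀ * asymmetry k₀ ε) ^ 2 := by ring
    _ ≤ ε ^ 2 := pow_le_pow_left₀ (mul_nonneg hk.le (asymmetry_nonneg hε hεk))
        (mul_asymmetry_le hε hεk) 2

end Asymmetry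

theorem two_mul_div_bounds {N ε : ℝ} (hN : 2 ≤ N) (hε : 0 ≤ ε) :
    2 * ε / (N - 1 / 2) ≤ 2 * ε / (N - 1) ∧
      2 * ε / (N - 1) ≤ 2 * ε / (N - 1 / 2) + 4 * (ε / N ^ 2) := by
  refine ⟨div_le_div_of_nonneg_left (by linarith) (by linarith) (by linarith), ?_⟩
  have h1 : N - 1 ≠ 0 := by linarith
  have h2 : N - 1 / 2 ≠ 0 := by linarith
  have h3 : 2 * ε / (N - 1) = 2 * ε / (N - 1 / 2) + ε * (1 / ((N - 1) * (N - 1 / 2))) := by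
    have hm : 2 * (N - 1 / 2) = 2 * (N - 1) + 1 := by ring
    generalize N - 1 / 2 = m at *
    generalize N - 1 = p at *
    field_simp
    linear_combination ε * hm
  have h4 : 1 / ((N - 1) * (N - 1 / 2)) ≤ 4 / N ^ 2 := by
    rw [div_le_div_iff₀ (mul_pos (by linarith) (by linarith)) (by positivity)]
    nlinarith
  rw [h3]
  calc _ ≤ 2 * ε / (N - 1 / 2) + ε * (4 / N ^ 2) :=
        add_le_add_right (mul_le_mul_of_nonneg_left h4 hε) _
    _ = _ := by ring

section Mode

variable {N : ℕ} {k₀ ε θ : ℝ}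

/-- Without mistuning the lowest frequency is `π / (2 N - 1)`. -/
theorem isFundamental_zero (hN : 2 ≤ N) (hk : 0 < k₀) :
    IsFundamental N k₀ 0 (Real.pi / (2 * N - 1)) := by
  have hN' : (2 : ℝ) ≤ N := by exact_mod_cast hN
  have hpos : 0 < 2 * (N : ℝ) - 1 := by linarith
  refine ⟨div_pos Real.pi_pos hpos, ?_, ?_⟩
  · rw [← mul_div_assoc, div_lt_iff₀ hpos]
    nlinarith [Real.pi_pos]
  · have h1 : decayRatio k₀ 0 = 1 := by
      have := Real.sqrt_sq hk.le
      simp [decayRatio, meanGain, this, hk.ne']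
    have h2 : N * (Real.pi / (2 * N - 1)) = Real.pi - (N - 1) * (Real.pi / (2 * N - 1)) := by
      rw [eq_sub_iff_add_eq, ← add_mul, mul_div_assoc', div_eq_iff hpos.ne']
      ring
    rw [h1, one_mul, h2, Real.sin_pi_sub]

theorem IsFundamental.sq_le (h : IsFundamental N k₀ ε θ) (hN : 2 ≤ N) :
    θ ^ 2 ≤ 10 / N ^ 2 := by
  have hN' : (2 : ℝ) ≤ N := by exact_mod_cast hN
  rw [le_div_iff₀ (by positivity), ← mul_pow, mul_comm]
  have h1 := h.lt
  have h2 : 0 < N * θ := mul_pos (by linarith) h.pos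
  nlinarith [Real.pi_lt_d2]

theorem IsFundamental.lt_pi_div_two (h : IsFundamental N k₀ ε θ) (hN : 2 ≤ N) :
    θ < Real.pi / 2 := by
  have hN' : (2 : ℝ) ≤ N := by exact_mod_cast hN
  nlinarith [h.pos, h.lt]

/-- The boundary condition in terms of the phase shift `δ = (N - 1 / 2) θ - π / 2`, which is zero for
the symmetric design: it says `tan δ * tan (θ / 2) = asymmetry k₀ ε`, and `0 ≤ δ < π / 2`. -/
theorem IsFundamental.phaseShift (h : IsFundamental N k₀ ε θ) (hN : 2 ≤ N) (hε : 0 ≤ ε)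
    (hεk : ε < k₀) :
    0 ≤ (N - 1 / 2) * θ - Real.pi / 2 ∧ (N - 1 / 2) * θ - Real.pi / 2 < Real.pi / 2 ∧
      Real.sin ((N - 1 / 2) * θ - Real.pi / 2) * Real.sin (θ / 2) =
        asymmetry k₀ ε *
          (Real.cos ((N - 1 / 2) * θ - Real.pi / 2) * Real.cos (θ / 2)) := by
  have hN' : (2 : ℝ) ≤ N := by exact_mod_cast hN
  have hθ := h.pos
  have hθ' := h.lt
  have hκ := meanGain_pos hε hεk
  have hκ2 := meanGain_sq hε hεk
  have hm : 0 < (N - 1 / 2) * θ := mul_pos (by linarith) hθ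
  have hb := h.boundary
  have e1 : N * θ = (N - 1 / 2) * θ + θ / 2 := by ring
  have e2 : (N - 1) * θ = (N - 1 / 2) * θ - θ / 2 := by ring
  rw [e1, e2, Real.sin_add, Real.sin_sub] at hb
  have hs2 : 0 < Real.sin (θ / 2) :=
    Real.sin_pos_of_pos_of_lt_pi (by linarith) (by linarith [h.lt_pi (by omega)])
  have hc2 : 0 < Real.cos (θ / 2) :=
    Real.cos_pos_of_mem_Ioo ⟨by linarith [Real.pi_pos], by linarith [h.lt_pi (by omega)]⟩
  have heq : Real.sin ((N - 1 / 2) * θ - Real.pi / 2) * Real.sin (θ / 2) =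
        asymmetry k₀ ε *
          (Real.cos ((N - 1 / 2) * θ - Real.pi / 2) * Real.cos (θ / 2)) := by
    rw [Real.sin_sub_pi_div_two, Real.cos_sub_pi_div_two]
    have hr := add_mul_decayRatio hε hεk
    have h2 : k₀ + meanGain k₀ ε ≠ 0 := by linarith
    have h3 : k₀ + ε + meanGain k₀ ε ≠ 0 := by linarith
    set S := Real.sin ((N - 1 / 2) * θ) * Real.cos (θ / 2) with hS
    set C := Real.cos ((N - 1 / 2) * θ) * Real.sin (θ / 2) with hC
    have hb' : (k₀ + ε) * (S + C) = meanGain k₀ ε * (S - C) := by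
      rw [hb, ← hr]
      ring
    rw [asymmetry, neg_mul, div_mul_eq_mul_div, eq_div_iff h2]
    refine mul_left_cancel₀ h3 ?_
    linear_combination (-(k₀ + meanGain k₀ ε)) * hb' - S * hκ2
  have hlt : (N - 1 / 2) * θ - Real.pi / 2 < Real.pi / 2 := by linarith
  refine ⟨?_, hlt, heq⟩
  by_contra! hneg
  have hcos : 0 < Real.cos ((N - 1 / 2) * θ - Real.pi / 2) :=
    Real.cos_pos_of_mem_Ioo ⟨by linarith, hlt⟩
  have hsin : Real.sin ((N - 1 / 2) * θ - Real.pi / 2) < 0 :=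
    Real.sin_neg_of_neg_of_neg_pi_lt hneg (by linarith [Real.pi_pos])
  have h1 := mul_neg_of_neg_of_pos hsin hs2
  rw [heq] at h1
  have h2 : 0 ≤ asymmetry k₀ ε *
      (Real.cos ((N - 1 / 2) * θ - Real.pi / 2) * Real.cos (θ / 2)) :=
    mul_nonneg (asymmetry_nonneg hε hεk) (mul_pos hcos hc2).le
  linarith

/-- The bookkeeping for `modeValue_sub_bounds`, with `X` in place of the gap between the cosines of
the two frequencies, `c` in place of `cos θ` and a real number `M` of nodes. -/
theorem mode_error_bounds {M c X : ℝ} (hM : 2 ≤ M) (hε : 0 ≤ ε) (hεk : ε < k₀)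
    (hm : 1 ≤ M - 1 / 2) (hθ : θ ^ 2 ≤ 10 / M ^ 2) (hX0 : 0 ≤ X)
    (hXup : X ≤ 2 * asymmetry k₀ ε / (M - 1 / 2))
    (hXlo : 2 * asymmetry k₀ ε / (M - 1 / 2) - 2 * (asymmetry k₀ ε * θ ^ 2) -
      6 * asymmetry k₀ ε ^ 2 ≤ X) (hc0 : 0 ≤ c) (hc1 : c ≤ 1) :
    0 ≤ 2 * k₀ * X + 2 * (ε * asymmetry k₀ ε) * c ∧
      |2 * k₀ * X + 2 * (ε * asymmetry k₀ ε) * c - 2 * ε / (M - 1)| ≤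
        44 * (ε / M ^ 2) + 12 / k₀ * ε ^ 2 := by
  have hk : 0 < k₀ := hε.trans_lt hεk
  have hη0 := asymmetry_nonneg hε hεk
  have hη1 := asymmetry_le_one hε hεk
  have hη2 := two_mul_asymmetry hε hεk
  have hηε := mul_asymmetry_le_sq_div hε hεk
  have hkη2 := mul_asymmetry_sq_le hε hεk
  obtain ⟨hN1, hN2⟩ := two_mul_div_bounds hM hε
  have hkηθ : k₀ * (asymmetry k₀ ε * θ ^ 2) ≤ 10 * (ε / M ^ 2) := by
    calc k₀ * (asymmetry k₀ ε * θ ^ 2) = k₀ * asymmetry k₀ ε * θ ^ 2 := by ring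
      _ ≤ ε * (10 / M ^ 2) := mul_le_mul (mul_asymmetry_le hε hεk) hθ (sq_nonneg _) hε
      _ = 10 * (ε / M ^ 2) := by ring
  have hmain : 2 * k₀ * (2 * asymmetry k₀ ε / (M - 1 / 2)) =
      2 * ε / (M - 1 / 2) + 2 * ε * asymmetry k₀ ε ^ 2 / (M - 1 / 2) := by
    rw [← mul_div_assoc, ← add_div]
    congr 1
    linear_combination 2 * hη2
  have hm3 : 0 ≤ 2 * ε * asymmetry k₀ ε ^ 2 / (M - 1 / 2) :=
    div_nonneg (by positivity) (by linarith)
  have hεη : 0 ≤ ε * asymmetry k₀ ε := mul_nonneg hε hη0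
  have hm2 : 2 * ε * asymmetry k₀ ε ^ 2 / (M - 1 / 2) ≤ 2 * (ε * asymmetry k₀ ε) := by
    refine (div_le_self (by positivity) hm).trans ?_
    calc 2 * ε * asymmetry k₀ ε ^ 2 = 2 * (ε * asymmetry k₀ ε) * asymmetry k₀ ε := by ring
      _ ≤ 2 * (ε * asymmetry k₀ ε) := mul_le_of_le_one_right (by linarith) hη1
  have he : 12 / k₀ * ε ^ 2 = 12 * (ε ^ 2 / k₀) := by ring
  have he0 : 0 ≤ ε ^ 2 / k₀ := by positivity
  have hεN : 0 ≤ ε / M ^ 2 := by positivity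
  have hc2 : 0 ≤ 2 * (ε * asymmetry k₀ ε) * c := by positivity
  have hc3 : 2 * (ε * asymmetry k₀ ε) * c ≤ 2 * (ε * asymmetry k₀ ε) :=
    mul_le_of_le_one_right (by linarith) hc1
  have hu := mul_le_mul_of_nonneg_left hXup (show 0 ≤ 2 * k₀ by linarith)
  have hl := mul_le_mul_of_nonneg_left hXlo (show 0 ≤ 2 * k₀ by linarith)
  have hl' : 2 * k₀ * (2 * asymmetry k₀ ε / (M - 1 / 2)) -
      4 * (k₀ * (asymmetry k₀ ε * θ ^ 2)) - 12 * (k₀ * asymmetry k₀ ε ^ 2) ≤ 2 * k₀ * X := by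
    linarith
  rw [hmain] at hu hl'
  rw [he]
  exact ⟨by positivity, abs_le.2 ⟨by linarith, by linarith⟩⟩

/-- The shift of the lowest eigenvalue caused by mistuning is `2 ε / (N - 1)`, with an error that is
uniform in `N` and `ε`. -/
theorem modeValue_sub_bounds (h : IsFundamental N k₀ ε θ) (hN : 2 ≤ N) (hε : 0 ≤ ε)
    (hεk : ε < k₀) :
    0 ≤ modeValue k₀ ε θ - modeValue k₀ 0 (Real.pi / (2 * N - 1)) ∧
    |modeValue k₀ ε θ - modeValue k₀ 0 (Real.pi / (2 * N - 1)) - 2 * ε / (N - 1)| ≤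
      44 * (ε / N ^ 2) + 12 / k₀ * ε ^ 2 := by
  have hN' : (2 : ℝ) ≤ N := by exact_mod_cast hN
  obtain ⟨hδ0, hδ1, hδ⟩ := h.phaseShift hN hε hεk
  have hk : 0 < k₀ := hε.trans_lt hεk
  have hm1 : 1 ≤ (N : ℝ) - 1 / 2 := by linarith
  obtain ⟨hup, hlo⟩ := phaseShift_bounds hδ0 hδ1 h.pos (h.lt_pi (by omega)) hδ
  have hmθ₀ : ((N : ℝ) - 1 / 2) * (Real.pi / (2 * N - 1)) = Real.pi / 2 := by
    have : 2 * (N : ℝ) - 1 ≠ 0 := by linarith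
    rw [mul_div_assoc', div_eq_iff this]
    ring
  have hθ₀ : 0 < Real.pi / (2 * (N : ℝ) - 1) := div_pos Real.pi_pos (by linarith)
  have hdiff : modeValue k₀ ε θ - modeValue k₀ 0 (Real.pi / (2 * N - 1)) =
      2 * k₀ * (Real.cos (Real.pi / (2 * N - 1)) - Real.cos θ) +
        2 * (ε * asymmetry k₀ ε) * Real.cos θ := by
    have h0 : meanGain k₀ 0 = k₀ := by simp [meanGain, Real.sqrt_sq hk.le]
    rw [← meanGain_sub hε hεk]
    simp only [modeValue, h0]
    ring
  rw [hdiff]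
  rw [← hmθ₀, ← mul_sub] at hδ0 hup hlo
  generalize Real.pi / (2 * (N : ℝ) - 1) = θ₀ at *
  have hθθ₀ : θ₀ ≤ θ := sub_nonneg.1 (nonneg_of_mul_nonneg_right hδ0 (by linarith))
  obtain ⟨hXup, hXlo⟩ := cos_gap_bounds hm1 hmθ₀ hθθ₀ (h.lt_pi_div_two hN).le
    (asymmetry_nonneg hε hεk) hup hlo
  have hX0 : 0 ≤ Real.cos θ₀ - Real.cos θ := sub_nonneg.2 <|
    Real.cos_le_cos_of_nonneg_of_le_pi hθ₀.le (h.lt_pi (by omega)).le hθθ₀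
  have hcos : 0 ≤ Real.cos θ := Real.cos_nonneg_of_mem_Icc
    ⟨by linarith [Real.pi_pos, h.pos], (h.lt_pi_div_two hN).le⟩
  exact mode_error_bounds hN' hε hεk hm1 (h.sq_le hN) hX0 hXup hXlo hcos (Real.cos_le_one θ)

theorem modeValue_le (h : IsFundamental N k₀ ε θ) (hN : 2 ≤ N) (hε : 0 ≤ ε) (hεk : ε < k₀) :
    modeValue k₀ ε θ ≤ 10 * k₀ / N ^ 2 + 2 * ε ^ 2 / k₀ := by
  have hk : 0 < k₀ := hε.trans_lt hεk
  have hκ := meanGain_pos hε hεk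
  have hsub := meanGain_sub hε hεk
  have hη := mul_asymmetry_le_sq_div hε hεk
  have hη0 : 0 ≤ ε * asymmetry k₀ ε := mul_nonneg hε (asymmetry_nonneg hε hεk)
  have hcos := Real.one_sub_sq_div_two_le_cos (x := θ)
  have hcos1 := Real.cos_le_one θ
  have h1 := mul_le_mul_of_nonneg_left (h.sq_le hN) hk.le
  have e1 : k₀ * (10 / (N : ℝ) ^ 2) = 10 * k₀ / N ^ 2 := by ring
  have e2 : 2 * ε ^ 2 / k₀ = 2 * (ε ^ 2 / k₀) := by ring
  rw [e1] at h1
  rw [e2]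
  unfold modeValue
  nlinarith

end Mode

/-! ### Asymptotics of the stability margin -/

theorem slowRate_le_two_mul_div {b μ : ℝ} (hb : 0 < b) (hμ0 : 0 ≤ μ) (hμ : 4 * μ ≤ b ^ 2) :
    slowRate b μ ≤ 2 * μ / b := by
  have h1 := slowRate_eq hμ
  have h2 := slowRate_le b μ
  have h3 := slowRate_nonneg hb.le hμ0
  rw [le_div_iff₀ hb]
  nlinarith

/-- The slow rate is `μ / b` to first order: the slow rates `s`, `t` of `μ`, `ν` satisfy
`(t - s) * (b - (t + s)) = ν - μ`. -/
theorem slowRate_sub_bounds {b μ ν : ℝ} (hb : 0 < b) (hμ0 : 0 ≤ μ) (hμν : μ ≤ ν)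
    (h : μ + ν ≤ b ^ 2 / 4) :
    0 ≤ slowRate b ν - slowRate b μ - (ν - μ) / b ∧
      slowRate b ν - slowRate b μ - (ν - μ) / b ≤ 4 * ((ν - μ) * (μ + ν)) / b ^ 3 := by
  have hμ : 4 * μ ≤ b ^ 2 := by linarith
  have hν : 4 * ν ≤ b ^ 2 := by linarith
  have e1 := slowRate_eq hμ
  have e2 := slowRate_eq hν
  have l1 := slowRate_le_two_mul_div hb hμ0 hμ
  have l2 := slowRate_le_two_mul_div hb (hμ0.trans hμν) hν
  have p1 := slowRate_nonneg hb.le hμ0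
  have p2 := slowRate_nonneg hb.le (hμ0.trans hμν)
  have hle := slowRate_le_slowRate (b := b) hμν
  set s := slowRate b μ
  set t := slowRate b ν
  have hst : t + s ≤ 2 * (μ + ν) / b := by
    have : 2 * (μ + ν) / b = 2 * ν / b + 2 * μ / b := by ring
    linarith
  have hst2 : t + s ≤ b / 2 := by
    refine hst.trans ?_
    rw [div_le_iff₀ hb]
    linarith
  have hfac : (t - s) * (b - (t + s)) = ν - μ := by linear_combination e1 - e2
  have hts : t - s ≤ 2 * (ν - μ) / b := by
    rw [le_div_iff₀ hb]
    nlinarith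
  have hres : t - s - (ν - μ) / b = (t - s) * (t + s) / b := by
    field_simp
    linear_combination hfac
  rw [hres]
  refine ⟨div_nonneg (mul_nonneg (by linarith) (by linarith)) hb.le, ?_⟩
  have := mul_le_mul hts hst (by linarith)
    (div_nonneg (by linarith) hb.le)
  calc (t - s) * (t + s) / b ≤ 2 * (ν - μ) / b * (2 * (μ + ν) / b) / b :=
        div_le_div_of_nonneg_right this hb.le
    _ = 4 * ((ν - μ) * (μ + ν)) / b ^ 3 := by
        field_simp
        ring

/-- From the eigenvalues `μ` (symmetric design) and `ν` (mistuned design) to the stability margins.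
The bounds on `ε` and `N` ensure `μ + ν ≤ b ^ 2 / 4`, so that both slow modes are overdamped. -/
theorem slowRate_error_bounds {k b ε N μ ν : ℝ} (hk : 0 < k) (hb : 0 < b) (hε : 0 ≤ ε)
    (hεk : ε < k) (hεb : ε < b ^ 2 / 16) (hN : 2 ≤ N) (hN' : 160 * k / b ^ 2 ≤ N) (hμ0 : 0 ≤ μ)
    (hμν : μ ≤ ν) (hμ : μ ≤ 10 * k / N ^ 2) (hν : ν ≤ 10 * k / N ^ 2 + 2 * ε ^ 2 / k)
    (hsub : |ν - μ - 2 * ε / (N - 1)| ≤ 44 * (ε / N ^ 2) + 12 / k * ε ^ 2) :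
    4 * μ ≤ b ^ 2 ∧ 4 * ν ≤ b ^ 2 ∧
      |slowRate b ν - slowRate b μ - 2 * ε / (b * (N - 1))| ≤
        ((44 + 12 / k) / b + 4 * (500 * k + 50) / b ^ 3) * (ε / N ^ 2 + ε ^ 2) ∧
      slowRate b μ ≤ 20 * k / b / N ^ 2 := by
  have hN0 : 0 < N := by linarith
  have hNN : 2 * N ≤ N ^ 2 := by nlinarith
  have h1 : 10 * k / N ^ 2 ≤ b ^ 2 / 16 := by
    rw [div_le_iff₀ (by positivity)] at hN' ⊢
    nlinarith [mul_le_mul_of_nonneg_right hNN (sq_nonneg b)]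
  have hε2 : ε ^ 2 / k ≤ ε := by
    rw [div_le_iff₀ hk]
    nlinarith
  have e1 : 2 * ε ^ 2 / k = 2 * (ε ^ 2 / k) := by ring
  have e2 : 12 / k * ε ^ 2 = 12 * (ε ^ 2 / k) := by ring
  have hsum : μ + ν ≤ b ^ 2 / 4 := by linarith
  have hμb : 4 * μ ≤ b ^ 2 := by linarith
  have hνb : 4 * ν ≤ b ^ 2 := by linarith
  obtain ⟨hlo, hup⟩ := slowRate_sub_bounds hb hμ0 hμν hsum
  refine ⟨hμb, hνb, ?_, ?_⟩
  · have hεN : ε / N ^ 2 ≤ ε / 4 := div_le_div_of_nonneg_left hε (by norm_num) (by linarith)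
    have hεN1 : 2 * ε / (N - 1) ≤ 2 * ε := div_le_self (by linarith) (by linarith)
    have hgap : ν - μ ≤ 25 * ε := by linarith [(abs_le.1 hsub).2]
    have hprod : (ν - μ) * (μ + ν) ≤ (500 * k + 50) * (ε / N ^ 2 + ε ^ 2) := by
      have h3 : (ν - μ) * (μ + ν) ≤ 25 * ε * (20 * k / N ^ 2 + 2 * (ε ^ 2 / k)) := by
        have e3 : 20 * k / N ^ 2 = 2 * (10 * k / N ^ 2) := by ring
        exact mul_le_mul hgap (by linarith) (by linarith) (by linarith)
      have h4 : 25 * ε * (20 * k / N ^ 2 + 2 * (ε ^ 2 / k)) =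
          500 * k * (ε / N ^ 2) + 50 * (ε * (ε ^ 2 / k)) := by ring
      have h5 := mul_le_mul_of_nonneg_left hε2 hε
      have h6 : 0 ≤ ε / N ^ 2 := by positivity
      have h7 : 0 ≤ k * ε ^ 2 := by positivity
      linarith
    have hquad : 4 * ((ν - μ) * (μ + ν)) / b ^ 3 ≤
        4 * (500 * k + 50) / b ^ 3 * (ε / N ^ 2 + ε ^ 2) := by
      rw [div_mul_eq_mul_div]
      exact div_le_div_of_nonneg_right (by linarith) (by positivity)
    have hlin : |(ν - μ) / b - 2 * ε / (b * (N - 1))| ≤ (44 + 12 / k) / b * (ε / N ^ 2 + ε ^ 2) := by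
      have e4 : (ν - μ) / b - 2 * ε / (b * (N - 1)) = (ν - μ - 2 * ε / (N - 1)) / b := by
        rw [sub_div (ν - μ), div_div, mul_comm b]
      rw [e4, abs_div, abs_of_pos hb, div_mul_eq_mul_div]
      refine div_le_div_of_nonneg_right (hsub.trans ?_) hb.le
      have h8 : 0 ≤ 12 / k * (ε / N ^ 2) := by positivity
      linarith [sq_nonneg ε]
    rw [add_mul]
    calc |slowRate b ν - slowRate b μ - 2 * ε / (b * (N - 1))|
        = |((ν - μ) / b - 2 * ε / (b * (N - 1))) +
            (slowRate b ν - slowRate b μ - (ν - μ) / b)| := by congr 1; ring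
      _ ≤ _ := (abs_add_le _ _).trans
          (add_le_add hlin ((abs_of_nonneg hlo).le.trans (hup.trans hquad)))
  · calc slowRate b μ ≤ 2 * μ / b := slowRate_le_two_mul_div hb hμ0 hμb
      _ ≤ 2 * (10 * k / N ^ 2) / b := by gcongr
      _ = 20 * k / b / N ^ 2 := by ring

end Formation

theorem theorem2 (k₀ b₀ : ℝ) (hk₀ : 0 < k₀) (hb₀ : 0 < b₀) :
    ∃ (n₀ : ℕ) (ε₀ C : ℝ), 0 < ε₀ ∧ ε₀ ≤ k₀ ∧
      ∀ (D : ℕ) (n : Fin (D + 1) → ℕ), n₀ ≤ n 0 → 2 ≤ n 0 → (∀ d, 1 ≤ n d) →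
      ∀ ε : ℝ, 0 < ε → ε < ε₀ →
        -- the mistuned gains satisfy the constraint and maximize the stability margin
        (Formation.mistunedGain n k₀ ε ∈ Formation.admissible n k₀ ε ∧
          IsMaxOn (fun k => Formation.stabilityMargin k (fun _ => b₀))
            (Formation.admissible n k₀ ε) (Formation.mistunedGain n k₀ ε)) ∧
        -- every maximizer has these gains between each vehicle and its two `x_1`-neighbours
        (∀ k ∈ Formation.admissible n k₀ ε,
          IsMaxOn (fun k => Formation.stabilityMargin k (fun _ => b₀))
            (Formation.admissible n k₀ ε) k →
          ∀ i j : Formation.Node n, ¬ Formation.IsReference i →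
            (Formation.IsNext i j → k i j = k₀ + ε) ∧
            (Formation.IsNext j i → k i j = k₀ - ε)) ∧
        -- the mistuned closed loop is stable
        (∀ s ∈ Formation.eigenvalues (Formation.mistunedGain n k₀ ε) (fun _ => b₀), s.re < 0) ∧
        -- the asymptotic formula for its stability margin
        |Formation.stabilityMargin (Formation.mistunedGain n k₀ ε) (fun _ => b₀)
            - 2 * ε / (b₀ * ((n 0 : ℝ) - 1))| ≤ C * (1 / (n 0 : ℝ) ^ 2 + ε ^ 2) ∧
        -- the same formula with the part of the remainder that does not vanish with `ε` identified
        -- as the stability margin of the symmetric design, which is of order `1 / n_1 ^ 2`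
        |Formation.stabilityMargin (Formation.mistunedGain n k₀ ε) (fun _ => b₀)
            - Formation.stabilityMargin (Formation.symmetricGain n k₀) (fun _ => b₀)
            - 2 * ε / (b₀ * ((n 0 : ℝ) - 1))| ≤ C * (ε / (n 0 : ℝ) ^ 2 + ε ^ 2) ∧
        Formation.stabilityMargin (Formation.symmetricGain n k₀) (fun _ => b₀)
          ≤ C / (n 0 : ℝ) ^ 2 := by
  open Formation in
  obtain ⟨n₀, hn₀⟩ := exists_nat_ge (160 * k₀ / b₀ ^ 2)
  set C₁ : ℝ := (44 + 12 / k₀) / b₀ + 4 * (500 * k₀ + 50) / b₀ ^ 3 with hC₁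
  set C₂ : ℝ := 20 * k₀ / b₀ with hC₂
  have hC₁0 : 0 ≤ C₁ := by positivity
  have hC₂0 : 0 ≤ C₂ := by positivity
  -- `b₀ ^ 2 / 16` and `n₀` keep the lowest eigenvalues in the overdamped range.
  refine ⟨n₀, min k₀ (b₀ ^ 2 / 16), C₁ * (1 + k₀) + C₂, by positivity, min_le_left _ _,
    fun D n hn0 hn2 hn ε hε hεlt => ?_⟩
  have hεk : ε < k₀ := hεlt.trans_le (min_le_left _ _)
  have hεb : ε < b₀ ^ 2 / 16 := hεlt.trans_le (min_le_right _ _)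
  have hN : (2 : ℝ) ≤ n 0 := by exact_mod_cast hn2
  have hN' : 160 * k₀ / b₀ ^ 2 ≤ n 0 := hn₀.trans (by exact_mod_cast hn0)
  obtain ⟨θ, hθ⟩ := exists_isFundamental hn2 hε.le hεk
  have hθ₀ := isFundamental_zero hn2 hk₀
  obtain ⟨hsub0, hsub⟩ := modeValue_sub_bounds hθ hn2 hε.le hεk
  have hν := modeValue_le hθ hn2 hε.le hεk
  have hμ := modeValue_le hθ₀ hn2 le_rfl hk₀
  have hμ0 := modeValue_pos le_rfl hk₀ hθ₀.pos (hθ₀.lt_pi (by omega))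
  have hν0 := modeValue_pos hε.le hεk hθ.pos (hθ.lt_pi (by omega))
  obtain ⟨hsmall, hlarge, herr, hbase⟩ := slowRate_error_bounds hk₀ hb₀ hε.le hεk hεb hN hN'
    hμ0.le (sub_nonneg.1 hsub0) (by simpa using hμ) hν hsub
  obtain ⟨hstable, hS⟩ := stabilityMargin_mistunedGain hn2 hn hb₀ hε.le hεk hθ hlarge
  obtain ⟨-, hS₀⟩ := stabilityMargin_mistunedGain hn2 hn hb₀ le_rfl hk₀ hθ₀ hsmall
  rw [mistunedGain_zero] at hS₀
  have hadm := mistunedGain_mem_admissible (n := n) (k₀ := k₀) hε.le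
  have hsq : 0 < (n 0 : ℝ) ^ 2 := by positivity
  have hC : C₁ ≤ C₁ * (1 + k₀) + C₂ := by nlinarith
  have hbase0 := slowRate_nonneg hb₀.le hμ0.le
  rw [← hC₁, ← hS, ← hS₀] at herr
  rw [← hC₂, ← hS₀] at hbase
  rw [← hS₀] at hbase0
  refine ⟨⟨hadm, fun k hk => ?_⟩, fun k hk hmax => ?_, hstable, ?_, ?_, ?_⟩
  · change stabilityMargin k _ ≤ stabilityMargin _ _
    rw [hS]
    exact (stabilityMargin_le_slowRate hn2 hn hb₀ hε.le hεk hθ hlarge hk).1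
  · obtain ⟨h1, h2⟩ := stabilityMargin_le_slowRate hn2 hn hb₀ hε.le hεk hθ hlarge hk
    exact h2 (le_antisymm h1 (hS ▸ hmax hadm))
  · have h1 : ε / (n 0 : ℝ) ^ 2 ≤ k₀ * (1 / (n 0 : ℝ) ^ 2) := by
      rw [mul_one_div]
      exact div_le_div_of_nonneg_right hεk.le hsq.le
    have h2 : C₂ / (n 0 : ℝ) ^ 2 = C₂ * (1 / (n 0 : ℝ) ^ 2) := by ring
    have h3 := abs_le.1 herr
    have h4 := mul_le_mul_of_nonneg_left h1 hC₁0
    have h5 : 0 ≤ (C₁ * k₀ + C₂) * ε ^ 2 := by positivity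
    have h6 : 0 ≤ C₁ * (1 / (n 0 : ℝ) ^ 2) := by positivity
    have h7 : 0 ≤ C₂ * (1 / (n 0 : ℝ) ^ 2) := by positivity
    exact abs_le.2 ⟨by linarith, by linarith⟩
  · exact herr.trans (mul_le_mul_of_nonneg_right hC (by positivity))
  · exact hbase.trans (div_le_div_of_nonneg_right (by nlinarith) hsq.le)
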